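/- **Proposition.** Let $K$ be any field and let $\mathcal{A}$ be a hyperplane arrangement over $K$, i.e. a finite set of affine hyperplanes in $K^d$. Let $\mathcal{L}(\mathcal{A})$ be its intersection poset: the nonempty intersections of subsets of $\mathcal{A}$ (including the empty intersection $\hat 0 = K^d$), ordered by reverse inclusion, with rank function $\mathrm{rk}$ (the maximal length of a chain from $\hat 0$) and Möbius function $\mu(x)=\mu(\hat 0,x)$; let $\mathrm{rk}(\mathcal{A})$ be the maximal rank of an element. The Poincaré polynomial of $\mathcal{A}$ is $$\pi_{\mathcal{A}}(Y)=\sum_{x\in\mathcal{L}(\mathcal{A})}\mu(x)(-Y)^{\mathrm{rk}(x)}\in\mathbb{Z}[Y].$$ For $x\in\mathcal{L}(\mathcal{A})$ put $\mathcal{A}_x=\{H\in\mathcal{A}: x\subseteq H\}$ and $\mathcal{A}_\varnothing=\mathcal{A}$, let $\mathcal{A}^x=\{x\cap H: H\in\mathcal{A}\setminus\mathcal{A}_x,\ x\cap H\neq\varnothing\}$ (an arrangement in the affine space $x$), and put $\mathcal{A}^x_y=(\mathcal{A}^x)_y$. For a poset $P$ let $\Delta(P)$ be its order complex, the simplicial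 complex of finite chains of $P$. For a (possibly empty) chain $F=(x_1<\dots<x_\ell)$ in $\mathcal{L}(\mathcal{A})\setminus\{\hat 0\}$ put $x_0=\hat 0$, $x_{\ell+1}=\varnothing$, $|F|=\ell$ and $\pi_F(Y)=\prod_{k=0}^{\ell}\pi_{\mathcal{A}^{x_k}_{x_{k+1}}}(Y)$. The coarse flag Hilbert–Poincaré series of $\mathcal{A}$ is $$\mathsf{cfHP}_{\mathcal{A}}(Y,T)=\sum_{F\in\Delta(\mathcal{L}(\mathcal{A})\setminus\{\hat 0\})}\pi_F(Y)\left(\frac{T}{1-T}\right)^{|F|}\in\mathbb{Q}(T)[Y],$$ and its numerator is the polynomial $\mathcal{N}_{\mathcal{A}}(Y,T)\in\mathbb{Q}[Y,T]$ defined by $$\mathsf{cfHP}_{\mathcal{A}}(Y,T)=\frac{\mathcal{N}_{\mathcal{A}}(Y,T)}{(1-T)^{\mathrm{rk}(\mathcal{A})}}.$$ For a field $\mathbb{F}$ and a simplicial complex $\Delta$ with finite vertex set $V$, let $\mathbb{F}[\Delta]=\mathbb{F}[X_v: v\in V]/\bigl(\prod_{v\in\sigma}X_v : \sigma\subseteq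 V,\ \sigma\notin\Delta\bigr)$ be the Stanley–Reisner ring, graded by $\deg X_v=1$, and let $\mathrm{Hilb}(\mathbb{F}[\Delta],T)=\sum_{k\ge 0}\dim_{\mathbb{F}}(\mathbb{F}[\Delta]_k)\,T^k$ be its Hilbert series. Then $$\mathcal{N}_{\mathcal{A}}(Y,0)=\pi_{\mathcal{A}}(Y),$$ and for every field $\mathbb{F}$ $$\frac{\mathsf{cfHP}_{\mathcal{A}}(0,T)}{1-T}=\mathrm{Hilb}\bigl(\mathbb{F}[\Delta(\mathcal{L}(\mathcal{A}))],T\bigr),$$ where the rational function on the left is expanded as a power series in $T$. Moreover, all coefficients of the polynomials $\mathcal{N}_{\mathcal{A}}(Y,0)$ and $\mathcal{N}_{\mathcal{A}}(0,T)$ are nonnegative. -/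

import Mathlib

open Polynomial

/-- `H` is a hyperplane of the affine subspace `E` of `K^d`: a nonempty affine subspace contained
in `E`, of dimension one less than that of `E`. -/
structure IsAffineHyperplane {K : Type*} [Field K] {d : ℕ}
    (E H : AffineSubspace K (Fin d → K)) : Prop where
  nonempty : (H : Set (Fin d → K)).Nonempty
  le : H ≤ E
  finrank_eq : Module.finrank K H.direction + 1 = Module.finrank K E.direction

/-- A hyperplane arrangement: a finite set of hyperplanes in an affine space over `K`. The ambient
space is a nonempty affine subspace of `K^d`; the arrangements in `K^d` itself are those with
`ambient = ⊤`. The greater generality makes restrictions to flats arrangements again. -/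
structure HyperplaneArrangement (K : Type*) [Field K] (d : ℕ) where
  ambient : AffineSubspace K (Fin d → K)
  ambient_nonempty : (ambient : Set (Fin d → K)).Nonempty
  hyperplanes : Finset (AffineSubspace K (Fin d → K))
  isHyperplane : ∀ H ∈ hyperplanes, IsAffineHyperplane ambient H

/-- If `x` is a nonempty affine subspace of `E`, and `H` is a hyperplane of `E` that meets `x` and
does not contain it, then `x ∩ H` is a hyperplane of `x`. -/
theorem IsAffineHyperplane.inf {K : Type*} [Field K] {d : ℕ}
    {E H x : AffineSubspace K (Fin d → K)} (h : IsAffineHyperplane E H) (hxE : x ≤ E)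
    (hxH : ¬ x ≤ H) (hne : ((x ⊓ H : AffineSubspace K (Fin d → K)) : Set (Fin d → K)).Nonempty) :
    IsAffineHyperplane x (x ⊓ H) := by
  obtain ⟨p, hp⟩ := hne
  refine ⟨⟨p, hp⟩, inf_le_left, ?_⟩
  have hdir := AffineSubspace.direction_inf_of_mem_inf (k := K) (p := p) (s₁ := x) (s₂ := H) hp
  have hpx : p ∈ x := hp.1
  have hpH : p ∈ H := hp.2
  have h1 : ¬ x.direction ≤ H.direction := by
    intro hle
    apply hxH
    intro q hq
    have : q -ᵥ p ∈ H.direction := hle (AffineSubspace.vsub_mem_direction hq hpx)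
    have := AffineSubspace.vadd_mem_of_mem_direction this hpH
    simpa using this
  have hxE' := AffineSubspace.direction_le hxE
  have hHE' := AffineSubspace.direction_le h.le
  have h2 := Submodule.finrank_sup_add_finrank_inf_eq x.direction H.direction
  have h3 : Module.finrank K H.direction
      < Module.finrank K (x.direction ⊔ H.direction : Submodule K (Fin d → K)) := by
    apply Submodule.finrank_lt_finrank_of_lt
    refine lt_of_le_of_ne le_sup_right ?_
    intro he
    exact h1 (he ▸ le_sup_left)
  have h4 : Module.finrank K (x.direction ⊔ H.direction : Submodule K (Fin d → K))
      ≤ Module.finrank K E.direction := Submodule.finrank_mono (sup_le hxE' hHE')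
  have h5 := h.finrank_eq
  rw [hdir]
  omega

/-- The order complex `Δ(P)` of a poset `P`: its faces are the nonempty finite chains of `P`
(in Mathlib's convention the empty face is not listed). -/
def orderComplex (P : Type*) [PartialOrder P] : AbstractSimplicialComplex P where
  faces := {σ | σ.Nonempty ∧ IsChain (· ≤ ·) (σ : Set P)}
  isRelLowerSet_faces := fun _σ hσ =>
    ⟨hσ.1, fun _τ hτσ hτ => ⟨hτ, hσ.2.mono (Finset.coe_subset.mpr hτσ)⟩⟩
  singleton_mem := fun v => ⟨Finset.singleton_nonempty v, by simp [IsChain]⟩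

section StanleyReisner

/-- The Stanley-Reisner ideal of `Δ` over `F`, generated by the squarefree monomials
`∏_{v ∈ σ} X_v` where `σ` is a non-face of `Δ` (the empty set counts as a face). -/
noncomputable def stanleyReisnerIdeal (F : Type*) [Field F] {ι : Type*} (Δ : AbstractSimplicialComplex ι) :
    Ideal (MvPolynomial ι F) :=
  Ideal.span {m | ∃ σ : Finset ι, σ.Nonempty ∧ σ ∉ Δ.faces ∧
    m = ∏ v ∈ σ, (MvPolynomial.X v : MvPolynomial ι F)}

/-- The Stanley-Reisner ring `F[Δ]`. -/
abbrev StanleyReisnerRing (F : Type*) [Field F] {ι : Type*} (Δ : AbstractSimplicialComplex ι) :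
    Type _ :=
  MvPolynomial ι F ⧸ stanleyReisnerIdeal F Δ

/-- The graded piece `F[Δ]_k`, for the grading in which every variable has degree one: the classes
of the homogeneous polynomials of degree `k`. -/
noncomputable def stanleyReisnerPiece (F : Type*) [Field F] {ι : Type*}
    (Δ : AbstractSimplicialComplex ι) (k : ℕ) : Submodule F (StanleyReisnerRing F Δ) :=
  (MvPolynomial.homogeneousSubmodule ι F k).map
    (Ideal.Quotient.mkₐ F (stanleyReisnerIdeal F Δ)).toLinearMap

/-- The (coarse) Hilbert series `∑_k dim_F(F[Δ]_k) T^k` of the Stanley-Reisner ring `F[Δ]`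
(of a complex with finitely many vertices), with rational coefficients. -/
noncomputable def stanleyReisnerHilbertSeries (F : Type*) [Field F] {ι : Type*}
    (Δ : AbstractSimplicialComplex ι) : PowerSeries ℚ :=
  PowerSeries.mk fun k => (Module.finrank F (stanleyReisnerPiece F Δ k) : ℚ)

open scoped RatFunc in
/-- The expansion of a rational function in `ℚ(T)` as a formal Laurent series at `T = 0`. -/
noncomputable def laurentExpansion : RatFunc ℚ →+* LaurentSeries ℚ :=
  algebraMap (RatFunc ℚ) (LaurentSeries ℚ)

end StanleyReisner

namespace HyperplaneArrangement

variable {K : Type*} [Field K] {d : ℕ}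

/-- The nonempty intersections of subsets of the arrangement; the empty subset gives the ambient
space. -/
def IsFlat (A : HyperplaneArrangement K d) (x : AffineSubspace K (Fin d → K)) : Prop :=
  (x : Set (Fin d → K)).Nonempty ∧
    ∃ B : Finset (AffineSubspace K (Fin d → K)), B ⊆ A.hyperplanes ∧
      x = A.ambient ⊓ ⨅ H ∈ B, H

/-- The intersection poset `L(A)`, ordered by reverse inclusion. -/
abbrev IntersectionPoset (A : HyperplaneArrangement K d) : Type _ :=
  {x : (AffineSubspace K (Fin d → K))ᵒᵈ // A.IsFlat (OrderDual.ofDual x)}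

/-- The affine subspace underlying an element of the intersection poset. -/
def IntersectionPoset.space {A : HyperplaneArrangement K d} (x : A.IntersectionPoset) :
    AffineSubspace K (Fin d → K) :=
  OrderDual.ofDual x.1

theorem IntersectionPoset.space_le_ambient {A : HyperplaneArrangement K d}
    (x : A.IntersectionPoset) : x.space ≤ A.ambient := by
  obtain ⟨_, B, _, hB⟩ := x.2
  unfold IntersectionPoset.space
  rw [hB]
  exact inf_le_left

instance (A : HyperplaneArrangement K d) : Finite A.IntersectionPoset := by
  classical
  let f : A.IntersectionPoset → A.hyperplanes.powerset := fun x =>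
    ⟨x.2.2.choose, Finset.mem_powerset.mpr x.2.2.choose_spec.1⟩
  refine Finite.of_injective f ?_
  intro x y hxy
  have h : x.2.2.choose = y.2.2.choose := congrArg Subtype.val hxy
  apply Subtype.ext
  apply OrderDual.ofDual.injective
  rw [x.2.2.choose_spec.2, y.2.2.choose_spec.2, h]

noncomputable instance (A : HyperplaneArrangement K d) : Fintype A.IntersectionPoset :=
  Fintype.ofFinite _

/-- The bottom element `0̂` of the intersection poset is the ambient space. -/
instance (A : HyperplaneArrangement K d) : OrderBot A.IntersectionPoset where
  bot := ⟨OrderDual.toDual A.ambient, A.ambient_nonempty, ∅, by simp, by simp⟩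
  bot_le x := x.space_le_ambient

/-- The rank of `x` in `L(A)`: the supremum of the lengths of the chains ending in `x`. -/
noncomputable def rk (A : HyperplaneArrangement K d) (x : A.IntersectionPoset) : ℕ :=
  (Order.height x).toNat

/-- The rank of `A`: the largest rank of an element of `L(A)`. -/
noncomputable def rank (A : HyperplaneArrangement K d) : ℕ :=
  Finset.univ.sup A.rk

open scoped Classical in
/-- The Möbius function value `μ(x) = μ(0̂, x)` of `L(A)`. -/
noncomputable def moebius (A : HyperplaneArrangement K d) (x : A.IntersectionPoset) : ℤ :=
  letI : LocallyFiniteOrder A.IntersectionPoset := Fintype.toLocallyFiniteOrder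
  IncidenceAlgebra.mu ℤ ⊥ x

/-- The Poincaré polynomial `π_A(Y) = ∑_{x ∈ L(A)} μ(x) (-Y)^{rk x}`. -/
noncomputable def poincare (A : HyperplaneArrangement K d) : ℤ[X] :=
  ∑ x : A.IntersectionPoset, C (A.moebius x) * (-X) ^ A.rk x

open scoped Classical in
/-- The subarrangement `A_y = {H ∈ A | y ⊆ H}`. For `y = ∅` (that is, `y = ⊥`) this is `A`. -/
noncomputable def sub (A : HyperplaneArrangement K d) (y : AffineSubspace K (Fin d → K)) :
    HyperplaneArrangement K d where
  ambient := A.ambient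
  ambient_nonempty := A.ambient_nonempty
  hyperplanes := A.hyperplanes.filter fun H => y ≤ H
  isHyperplane H hH := A.isHyperplane H (Finset.mem_filter.mp hH).1

open scoped Classical in
/-- The restriction `A^x = {x ∩ H | H ∈ A ∖ A_x, x ∩ H ≠ ∅}`, an arrangement in the flat `x`. -/
noncomputable def restrict (A : HyperplaneArrangement K d) (x : A.IntersectionPoset) :
    HyperplaneArrangement K d where
  ambient := x.space
  ambient_nonempty := x.2.1
  hyperplanes := (A.hyperplanes.filter fun H => ¬ x.space ≤ H ∧
    ((x.space ⊓ H : AffineSubspace K (Fin d → K)) : Set (Fin d → K)).Nonempty).image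
      fun H => x.space ⊓ H
  isHyperplane := by
    intro H' hH'
    obtain ⟨H, hH, rfl⟩ := Finset.mem_image.mp hH'
    obtain ⟨hHA, hxH, hne⟩ := Finset.mem_filter.mp hH
    exact (A.isHyperplane H hHA).inf x.space_le_ambient hxH hne

/-- For a flag `F = (x_1 < ⋯ < x_ℓ)` and an element `x`: the first member of `F` that is strictly
greater than `x` in `L(A)`, as an affine subspace, and `∅` if there is none. Since `L(A)` is ordered
by reverse inclusion, that member is the largest subspace among those of the later members, that
is, their supremum. -/
noncomputable def next (A : HyperplaneArrangement K d) (F : Finset A.IntersectionPoset)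
    (x : A.IntersectionPoset) : AffineSubspace K (Fin d → K) :=
  ⨆ y ∈ F, ⨆ _ : x < y, y.space

open scoped Classical in
/-- The flag Poincaré polynomial `π_F(Y) = ∏_{k=0}^{ℓ} π_{A^{x_k}_{x_{k+1}}}(Y)` of a flag
`F = (x_1 < ⋯ < x_ℓ)`, where `x_0 = 0̂` and `x_{ℓ+1} = ∅`. -/
noncomputable def flagPoincare (A : HyperplaneArrangement K d) (F : Finset A.IntersectionPoset) :
    ℤ[X] :=
  ∏ x ∈ insert ⊥ F, ((A.restrict x).sub (A.next F x)).poincare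

open scoped Classical in
/-- The faces of `Δ(L(A) ∖ {0̂})`, with the empty flag: the chains of `L(A)` that avoid `0̂`. -/
noncomputable def flags (A : HyperplaneArrangement K d) : Finset (Finset A.IntersectionPoset) :=
  Finset.univ.filter fun F => IsChain (· ≤ ·) (F : Set A.IntersectionPoset) ∧ ⊥ ∉ F

/-- The coarse flag Hilbert-Poincaré series
`cfHP_A(Y, T) = ∑_F π_F(Y) (T / (1 - T))^{|F|}`, an element of `ℚ(T)[Y]`. -/
noncomputable def coarseFlagHP (A : HyperplaneArrangement K d) : (RatFunc ℚ)[X] :=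
  ∑ F ∈ A.flags, (A.flagPoincare F).map (Int.castRingHom (RatFunc ℚ)) *
    C ((RatFunc.X / (1 - RatFunc.X)) ^ F.card)

/-- `N ∈ ℚ[T][Y]` satisfies `cfHP_A(Y, T) = N(Y, T) / (1 - T)^{rank A}`. The variable of the outer
polynomial ring is `Y`, the variable of the inner one is `T`. -/
def IsCoarseNumerator (A : HyperplaneArrangement K d) (N : ℚ[X][X]) : Prop :=
  A.coarseFlagHP =
    N.map (algebraMap ℚ[X] (RatFunc ℚ)) * C (((1 - RatFunc.X) ^ A.rank)⁻¹)

theorem card_le_rank (A : HyperplaneArrangement K d) {F : Finset A.IntersectionPoset}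
    (hF : F ∈ A.flags) : F.card ≤ A.rank := by
  classical
  obtain ⟨hc, hb⟩ := (Finset.mem_filter.mp hF).2
  have hfin : ∀ x : A.IntersectionPoset, Order.height x < ⊤ := by
    intro x
    refine lt_of_le_of_lt (b := ((Fintype.card A.IntersectionPoset : ℕ) : ℕ∞)) ?_
      (ENat.natCast_lt_top _)
    refine Order.height_le fun p _ => ?_
    exact_mod_cast (LTSeries.length_lt_card p).le
  have hlt : ∀ x y : A.IntersectionPoset, x < y → A.rk x < A.rk y := fun x y hxy =>
    by
    have h := Order.height_strictMono hxy (hfin x)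
    unfold rk
    rwa [← ENat.natCast_toNat (hfin x).ne, ← ENat.natCast_toNat (hfin y).ne, Nat.cast_lt] at h
  have hinj : Set.InjOn A.rk (F : Set A.IntersectionPoset) := by
    intro x hx y hy hxy
    by_contra hne
    rcases hc hx hy hne with h | h
    · exact (hlt _ _ (lt_of_le_of_ne h hne)).ne hxy
    · exact (hlt _ _ (lt_of_le_of_ne h (Ne.symm hne))).ne' hxy
  have hmaps : ∀ x ∈ F, A.rk x ∈ Finset.Icc 1 A.rank := by
    intro x hx
    have hx0 : (⊥ : A.IntersectionPoset) < x :=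
      bot_lt_iff_ne_bot.mpr fun h => hb (h ▸ hx)
    have := hlt _ _ hx0
    have h2 : A.rk x ≤ A.rank := Finset.le_sup (f := A.rk) (Finset.mem_univ x)
    exact Finset.mem_Icc.mpr ⟨by omega, h2⟩
  simpa using Finset.card_le_card_of_injOn A.rk hmaps hinj

theorem existsUnique_coarseNumerator (A : HyperplaneArrangement K d) :
    ∃! N : ℚ[X][X], A.IsCoarseNumerator N := by
  have h1 : (1 - RatFunc.X : RatFunc ℚ) = algebraMap ℚ[X] (RatFunc ℚ) (1 - X) := by simp
  have h0 : (1 - RatFunc.X : RatFunc ℚ) ≠ 0 := by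
    rw [h1, Ne, map_eq_zero_iff _ (RatFunc.algebraMap_injective ℚ)]
    intro h
    have := congrArg (Polynomial.eval 0) h
    simp at this
  have hu : ∀ N : ℚ[X][X], A.IsCoarseNumerator N ↔
      N.map (algebraMap ℚ[X] (RatFunc ℚ)) = A.coarseFlagHP * C ((1 - RatFunc.X) ^ A.rank) := by
    intro N
    have hC : (C (((1 - RatFunc.X : RatFunc ℚ) ^ A.rank)⁻¹) : (RatFunc ℚ)[X]) *
        C ((1 - RatFunc.X) ^ A.rank) = 1 := by
      rw [← C_mul, inv_mul_cancel₀ (pow_ne_zero _ h0), C_1]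
    unfold IsCoarseNumerator
    constructor
    · intro h
      rw [h, mul_assoc, hC, mul_one]
    · intro h
      rw [h, mul_assoc, mul_comm (C _) (C _), hC, mul_one]
  have hring : (algebraMap ℚ[X] (RatFunc ℚ)).comp (Int.castRingHom ℚ[X]) =
      Int.castRingHom (RatFunc ℚ) := RingHom.ext_int _ _
  have hN : (∑ F ∈ A.flags, (A.flagPoincare F).map (Int.castRingHom ℚ[X]) *
      C (X ^ F.card * (1 - X) ^ (A.rank - F.card))).map (algebraMap ℚ[X] (RatFunc ℚ)) =
      A.coarseFlagHP * C ((1 - RatFunc.X) ^ A.rank) := by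
    rw [coarseFlagHP, Finset.sum_mul, Polynomial.map_sum]
    refine Finset.sum_congr rfl fun F hF => ?_
    rw [Polynomial.map_mul, Polynomial.map_map, hring, mul_assoc, ← C_mul, Polynomial.map_C]
    congr 2
    rw [map_mul, map_pow, map_pow, ← h1, RatFunc.algebraMap_X, div_pow]
    have hle := A.card_le_rank hF
    have : (1 - RatFunc.X : RatFunc ℚ) ^ A.rank
        = (1 - RatFunc.X) ^ F.card * (1 - RatFunc.X) ^ (A.rank - F.card) := by
      rw [← pow_add]; congr 1; omega
    rw [this]
    have h2 := pow_ne_zero F.card h0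
    field_simp
  refine ⟨_, (hu _).mpr hN, fun N hN' => ?_⟩
  apply Polynomial.map_injective _ (RatFunc.algebraMap_injective ℚ)
  rw [(hu N).mp hN', hN]

/-- The numerator `N_A(Y, T)`, defined by `cfHP_A(Y, T) = N_A(Y, T) / (1 - T)^{rank A}`. -/
noncomputable def coarseNumerator (A : HyperplaneArrangement K d) : ℚ[X][X] :=
  A.existsUnique_coarseNumerator.choose

theorem coarseNumerator_spec (A : HyperplaneArrangement K d) :
    A.IsCoarseNumerator A.coarseNumerator :=
  A.existsUnique_coarseNumerator.choose_spec.1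

/-- The polynomial `N_A(Y, 0)` in `Y`. -/
noncomputable def coarseNumeratorTZero (A : HyperplaneArrangement K d) : ℚ[X] :=
  A.coarseNumerator.map (evalRingHom 0)

/-- The polynomial `N_A(0, T)` in `T`. -/
noncomputable def coarseNumeratorYZero (A : HyperplaneArrangement K d) : ℚ[X] :=
  A.coarseNumerator.eval 0

end HyperplaneArrangement

/-! Write t = T/(1-T). At T = 0 only the empty flag survives in the numerator, leaving π_A. At Y = 0
every Poincaré polynomial equals 1, so a flag F contributes t^|F|. Monomials with support exactly σ
have generating function t^|σ|, so the Hilbert series is the sum of t^|σ| over all chains of L(A).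
These chains form a cone with apex 0̂ over the flags, whence the factor 1 + t = 1/(1-T).

The coefficients of π_A are nonnegative because μ alternates in sign with the rank, which follows
from Weisner's theorem for an atom (`sum_moebius_inf_atom`).

N_A(0,T) is the h-polynomial of the complex of flags. Its nonnegativity comes from a numerical form
of a recursive shelling. The chains above x are built up one cover at a time: adding a cover b to a
set B of covers adds (h_b - h_{b,tr}) + T h_{b,tr}, where tr is the set of covers of b lying above
members of B (`chainHPolyThrough_insert`). Both terms are nonnegative by induction on the corank,
provided that tr is a good set. Good means spanning (the common directions are only those of the
whole arrangement) or nonempty with a common point. Good sets can be enlarged to the set of all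
covers, and shrunk to a single cover (or to nothing, if x is maximal), with good traces at each step
(`IsGoodCoverSet.exists_insert`, `IsGoodCoverSet.exists_erase`). The geometric tool is sliding: a
point common to several flats can be moved along a common direction v, without leaving them, until
it meets a given hyperplane not parallel to v. -/

/-! ### Chain complexes and their h-polynomials -/

section ChainPolynomial

variable {P : Type*} [PartialOrder P] [Fintype P]

open scoped Classical in
/-- The finite chains of elements strictly above `x`. -/
noncomputable def chainsAbove (x : P) : Finset (Finset P) :=
  Finset.univ.filter fun F => IsChain (· ≤ ·) (F : Set P) ∧ ∀ y ∈ F, x < y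

open scoped Classical in
/-- The finite chains above `x` that are empty or lie above some element of `B`. -/
noncomputable def chainsThrough (x : P) (B : Finset P) : Finset (Finset P) :=
  (chainsAbove x).filter fun F => F = ∅ ∨ ∃ b ∈ B, ∀ y ∈ F, b ≤ y

/-- The contribution of a chain `F` to the `h`-polynomial of a complex of dimension `n - 1`. -/
noncomputable def chainWeight (n : ℕ) (F : Finset P) : ℚ[X] :=
  X ^ F.card * (1 - X) ^ (n - F.card)

/-- The `h`-polynomial of the complex of chains above `x`. -/
noncomputable def chainHPoly (e : P → ℕ) (x : P) : ℚ[X] :=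
  ∑ F ∈ chainsAbove x, chainWeight (e x) F

/-- The `h`-polynomial of the complex of chains above `x` through `B`. -/
noncomputable def chainHPolyThrough (e : P → ℕ) (x : P) (B : Finset P) : ℚ[X] :=
  ∑ F ∈ chainsThrough x B, chainWeight (e x) F

open scoped Classical in
/-- The covers of `b` that lie above some element of `B`. -/
noncomputable def coverTrace (b : P) (B : Finset P) : Finset P :=
  Finset.univ.filter fun y => b ⋖ y ∧ ∃ b' ∈ B, b' ≤ y

open scoped Classical in
/-- The covers of `x`. -/
noncomputable def coversOf (x : P) : Finset P := Finset.univ.filter fun y => x ⋖ y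

theorem mem_chainsAbove {x : P} {F : Finset P} :
    F ∈ chainsAbove x ↔ IsChain (· ≤ ·) (F : Set P) ∧ ∀ y ∈ F, x < y := by
  simp [chainsAbove]

theorem mem_chainsThrough {x : P} {B F : Finset P} :
    F ∈ chainsThrough x B ↔ F ∈ chainsAbove x ∧ (F = ∅ ∨ ∃ b ∈ B, ∀ y ∈ F, b ≤ y) := by
  simp [chainsThrough]

theorem mem_coverTrace {b y : P} {B : Finset P} :
    y ∈ coverTrace b B ↔ b ⋖ y ∧ ∃ b' ∈ B, b' ≤ y := by
  simp [coverTrace]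

theorem mem_coversOf {x y : P} : y ∈ coversOf x ↔ x ⋖ y := by
  simp [coversOf]

/-- A strictly decreasing `e` is injective on a chain and takes values below `e x` there. Hence the
subtraction in `chainWeight (e x) F` never truncates. -/
theorem card_le_of_mem_chainsAbove {e : P → ℕ} (he : StrictAnti e) {x : P} {F : Finset P}
    (hF : F ∈ chainsAbove x) : F.card ≤ e x := by
  obtain ⟨hc, hx⟩ := mem_chainsAbove.mp hF
  have hinj : Set.InjOn e (F : Set P) := by
    intro y hy z hz hyz
    by_contra hne
    rcases hc hy hz hne with h | h
    · exact (he (lt_of_le_of_ne h hne)).ne' hyz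
    · exact (he (lt_of_le_of_ne h (Ne.symm hne))).ne hyz
  have hmaps : ∀ y ∈ F, e y ∈ Finset.range (e x) := fun y hy =>
    Finset.mem_range.mpr (he (hx y hy))
  simpa using Finset.card_le_card_of_injOn e hmaps hinj

/-- A nonempty finite chain has a least element. -/
theorem exists_least_of_isChain {P : Type*} [PartialOrder P] {F : Finset P} (hF : F.Nonempty)
    (hc : IsChain (· ≤ ·) (F : Set P)) : ∃ z ∈ F, ∀ y ∈ F, z ≤ y := by
  obtain ⟨z, hz⟩ := F.exists_minimal hF
  refine ⟨z, hz.1, fun y hy => ?_⟩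
  rcases hc.total hz.1 hy with h | h
  · exact h
  · exact hz.2 hy h

open scoped Classical in
/-- The chains gained when a new cover `b` of `x` is added to `B`: those containing `b`, and those
above `b` that avoid the trace of `B`. -/
theorem chainsThrough_insert {x b : P} {B : Finset P} (hb : x ⋖ b)
    (hjoin : ∀ b' ∈ B, ∀ z, b < z → b' ≤ z → ∃ y, b ⋖ y ∧ b' ≤ y ∧ y ≤ z) :
    chainsThrough x (insert b B) = chainsThrough x B ∪ ((chainsAbove b).image (insert b) ∪
      (chainsAbove b \ chainsThrough b (coverTrace b B))) := by
  ext F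
  simp only [Finset.mem_union, Finset.mem_image, Finset.mem_sdiff]
  constructor
  · intro hF
    by_cases hFB : F ∈ chainsThrough x B
    · exact Or.inl hFB
    right
    obtain ⟨hFx, hF⟩ := mem_chainsThrough.mp hF
    obtain ⟨hc, hx⟩ := mem_chainsAbove.mp hFx
    -- The empty chain goes through every `B`, so it is never gained.
    have hne : F ≠ ∅ := fun h => hFB (mem_chainsThrough.mpr ⟨hFx, Or.inl h⟩)
    have hbF : ∀ y ∈ F, b ≤ y := by
      rcases hF with h | ⟨b', hb', h⟩
      · exact absurd h hne
      rcases Finset.mem_insert.mp hb' with rfl | hb'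
      · exact h
      · exact absurd (mem_chainsThrough.mpr ⟨hFx, Or.inr ⟨b', hb', h⟩⟩) hFB
    by_cases hmem : b ∈ F
    · left
      refine ⟨F.erase b, mem_chainsAbove.mpr ⟨hc.mono ?_, fun y hy => ?_⟩,
        Finset.insert_erase hmem⟩
      · exact_mod_cast Finset.erase_subset b F
      · exact lt_of_le_of_ne (hbF y (Finset.mem_of_mem_erase hy)) (Finset.ne_of_mem_erase hy).symm
    · right
      refine ⟨mem_chainsAbove.mpr ⟨hc, fun y hy => lt_of_le_of_ne (hbF y hy) ?_⟩, fun h => ?_⟩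
      · rintro rfl
        exact hmem hy
      · rcases (mem_chainsThrough.mp h).2 with h | ⟨y, hy, h⟩
        · exact hne h
        · obtain ⟨-, b', hb', hb'y⟩ := mem_coverTrace.mp hy
          exact hFB (mem_chainsThrough.mpr
            ⟨hFx, Or.inr ⟨b', hb', fun z hz => hb'y.trans (h z hz)⟩⟩)
  · rintro (hF | ⟨F', hF', rfl⟩ | ⟨hF, -⟩)
    · obtain ⟨hFx, hF⟩ := mem_chainsThrough.mp hF
      refine mem_chainsThrough.mpr ⟨hFx, hF.imp_right ?_⟩
      rintro ⟨b', hb', h⟩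
      exact ⟨b', Finset.mem_insert_of_mem hb', h⟩
    · obtain ⟨hc, hx⟩ := mem_chainsAbove.mp hF'
      refine mem_chainsThrough.mpr ⟨mem_chainsAbove.mpr ⟨?_, ?_⟩,
        Or.inr ⟨b, Finset.mem_insert_self _ _, ?_⟩⟩
      · rw [Finset.coe_insert]
        exact hc.insert fun y hy _ => Or.inl (hx y hy).le
      · intro y hy
        rcases Finset.mem_insert.mp hy with rfl | hy
        · exact hb.lt
        · exact hb.lt.trans (hx y hy)
      · intro y hy
        rcases Finset.mem_insert.mp hy with rfl | hy
        · exact le_rfl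
        · exact (hx y hy).le
    · obtain ⟨hc, hx⟩ := mem_chainsAbove.mp hF
      exact mem_chainsThrough.mpr ⟨mem_chainsAbove.mpr ⟨hc, fun y hy => hb.lt.trans (hx y hy)⟩,
        Or.inr ⟨b, Finset.mem_insert_self _ _, fun y hy => (hx y hy).le⟩⟩

/-- Distinct covers of `x` are incomparable, so no chain containing `b` lies above a member of `B`.
-/
theorem insert_notMem_chainsThrough {x b : P} {B : Finset P} (hb : x ⋖ b) (hbB : b ∉ B)
    (hB : ∀ b' ∈ B, x ⋖ b') {F : Finset P} (hbF : b ∈ F) : F ∉ chainsThrough x B := by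
  intro h
  rcases (mem_chainsThrough.mp h).2 with h | ⟨b', hb', h⟩
  · simp [h] at hbF
  · have := h b hbF
    rcases hb.eq_or_eq (hB b' hb').lt.le this with h | h
    · exact (hB b' hb').lt.ne' h
    · exact hbB (h ▸ hb')

/-- If the chain also lay above some `b' ∈ B`, its least element would be above both `b` and `b'`.
The element supplied by `hjoin` then belongs to the trace and lies below the whole chain. -/
theorem notMem_chainsThrough_of_notMem_trace {x b : P} {B : Finset P}
    (hjoin : ∀ b' ∈ B, ∀ z, b < z → b' ≤ z → ∃ y, b ⋖ y ∧ b' ≤ y ∧ y ≤ z)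
    {F : Finset P} (hF : F ∈ chainsAbove b) (hFt : F ∉ chainsThrough b (coverTrace b B)) :
    F ∉ chainsThrough x B := by
  intro h
  have hne : F ≠ ∅ := fun h => hFt (mem_chainsThrough.mpr ⟨hF, Or.inl h⟩)
  obtain ⟨hc, hb⟩ := mem_chainsAbove.mp hF
  obtain ⟨z, hz, hzF⟩ := exists_least_of_isChain (Finset.nonempty_iff_ne_empty.mpr hne) hc
  rcases (mem_chainsThrough.mp h).2 with h | ⟨b', hb', h⟩
  · exact hne h
  · obtain ⟨y, hby, hb'y, hyz⟩ := hjoin b' hb' z (hb z hz) (h z hz)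
    exact hFt (mem_chainsThrough.mpr ⟨hF, Or.inr ⟨y, mem_coverTrace.mpr ⟨hby, b', hb', hb'y⟩,
      fun w hw => hyz.trans (hzF w hw)⟩⟩)

open scoped Classical in
-- The gained chains containing `b` contribute `X * h_b`. Those that avoid `b` and the trace
-- contribute `(1 - X) * (h_b - h_tr)`, the extra factor coming from `e x = e b + 1`. The sum is
-- rearranged so that each summand can be shown nonnegative separately.
theorem chainHPolyThrough_insert {e : P → ℕ} (he : StrictAnti e) {x b : P} {B : Finset P}
    (hb : x ⋖ b) (heb : e b + 1 = e x) (hbB : b ∉ B) (hB : ∀ b' ∈ B, x ⋖ b')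
    (hjoin : ∀ b' ∈ B, ∀ z, b < z → b' ≤ z → ∃ y, b ⋖ y ∧ b' ≤ y ∧ y ≤ z) :
    chainHPolyThrough e x (insert b B) = chainHPolyThrough e x B +
      ((chainHPoly e b - chainHPolyThrough e b (coverTrace b B)) +
        X * chainHPolyThrough e b (coverTrace b B)) := by
  have h1 : ∑ F ∈ (chainsAbove b).image (insert b), chainWeight (e x) F = X * chainHPoly e b := by
    have hnot : ∀ F ∈ chainsAbove b, b ∉ F := fun F hF h =>
      lt_irrefl _ ((mem_chainsAbove.mp hF).2 b h)
    rw [Finset.sum_image, chainHPoly, Finset.mul_sum]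
    · refine Finset.sum_congr rfl fun F hF => ?_
      rw [chainWeight, chainWeight, Finset.card_insert_of_notMem (hnot F hF), ← heb,
        Nat.add_sub_add_right, pow_succ]
      ring
    · intro F hF G hG h
      have := congrArg (fun s => Finset.erase s b) h
      simpa [Finset.erase_insert (hnot F hF), Finset.erase_insert (hnot G hG)] using this
  have h2 : ∑ F ∈ chainsAbove b \ chainsThrough b (coverTrace b B), chainWeight (e x) F =
      (1 - X) * (chainHPoly e b - chainHPolyThrough e b (coverTrace b B)) := by
    have hsub : chainsThrough b (coverTrace b B) ⊆ chainsAbove b := Finset.filter_subset _ _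
    rw [chainHPoly, chainHPolyThrough, ← Finset.sum_sdiff hsub, add_sub_cancel_right,
      Finset.mul_sum]
    refine Finset.sum_congr rfl fun F hF => ?_
    have hle := card_le_of_mem_chainsAbove he (Finset.mem_sdiff.mp hF).1
    rw [chainWeight, chainWeight, ← heb, Nat.sub_add_comm hle, pow_succ]
    ring
  rw [chainHPolyThrough, chainsThrough_insert hb hjoin, Finset.sum_union,
    Finset.sum_union, h1, h2, ← chainHPolyThrough]
  · ring
  · rw [Finset.disjoint_left]
    intro F hF hF'
    obtain ⟨G, -, rfl⟩ := Finset.mem_image.mp hF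
    exact lt_irrefl _
      ((mem_chainsAbove.mp (Finset.mem_sdiff.mp hF').1).2 b (Finset.mem_insert_self _ _))
  · rw [Finset.disjoint_right]
    intro F hF
    rcases Finset.mem_union.mp hF with hF | hF
    · obtain ⟨G, -, rfl⟩ := Finset.mem_image.mp hF
      exact insert_notMem_chainsThrough hb hbB hB (Finset.mem_insert_self _ _)
    · obtain ⟨h, h'⟩ := Finset.mem_sdiff.mp hF
      exact notMem_chainsThrough_of_notMem_trace hjoin h h'

theorem chainHPolyThrough_empty (e : P → ℕ) (x : P) :
    chainHPolyThrough e x ∅ = (1 - X) ^ e x := by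
  have : chainsThrough x (∅ : Finset P) = {∅} := by
    ext F
    simp only [mem_chainsThrough, mem_chainsAbove, Finset.notMem_empty, false_and, exists_false,
      or_false, Finset.mem_singleton, and_iff_right_iff_imp]
    rintro rfl
    simp [IsChain]
  simp [chainHPolyThrough, this, chainWeight]

theorem coverTrace_empty (b : P) : coverTrace b (∅ : Finset P) = ∅ := by
  ext; simp [mem_coverTrace]

/-- The complex is a cone with apex `b`, and coning leaves the h-polynomial unchanged. -/
theorem chainHPolyThrough_singleton {e : P → ℕ} (he : StrictAnti e) {x b : P}
    (hb : x ⋖ b) (heb : e b + 1 = e x) : chainHPolyThrough e x {b} = chainHPoly e b := by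
  classical
  have := chainHPolyThrough_insert he (B := ∅) hb heb (by simp) (by simp) (by simp)
  rw [coverTrace_empty, chainHPolyThrough_empty, chainHPolyThrough_empty, insert_empty_eq] at this
  rw [this, ← heb, pow_succ]
  ring

theorem chainHPolyThrough_coversOf (e : P → ℕ) (x : P) :
    chainHPolyThrough e x (coversOf x) = chainHPoly e x := by
  classical
  unfold chainHPolyThrough chainHPoly
  congr 1
  ext F
  rw [mem_chainsThrough, and_iff_left_iff_imp]
  intro hF
  obtain ⟨hc, hx⟩ := mem_chainsAbove.mp hF
  rcases F.eq_empty_or_nonempty with h | h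
  · exact Or.inl h
  obtain ⟨z, hz, hzF⟩ := exists_least_of_isChain h hc
  obtain ⟨b, hb, hbz⟩ := exists_covBy_le_of_lt (hx z hz)
  exact Or.inr ⟨b, mem_coversOf.mpr hb, fun y hy => hbz.trans (hzF y hy)⟩

open scoped Classical in
/-- A family of good sets of covers through which the complexes of chains can be built up, one
cover at a time, so that each step is again governed by a good set. -/
structure IsGoodCoverFamily (e : P → ℕ) (Good : P → Finset P → Prop) : Prop where
  covBy : ∀ x B, Good x B → ∀ b ∈ B, x ⋖ b
  strictAnti : StrictAnti e
  covBy_corank : ∀ x b, x ⋖ b → e b + 1 = e x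
  corank_eq_zero : ∀ x, coversOf x = ∅ → e x = 0
  -- A local form of semimodularity, required only below a common upper bound, since two flats may
  -- be disjoint.
  join : ∀ x b b' : P, x ⋖ b → x ⋖ b' → b ≠ b' → ∀ z, b < z → b' ≤ z → ∃ y, b ⋖ y ∧ b' ≤ y ∧ y ≤ z
  extend : ∀ x B, Good x B → B ≠ coversOf x →
    ∃ b, x ⋖ b ∧ b ∉ B ∧ Good x (insert b B) ∧ Good b (coverTrace b B)
  remove : ∀ x B, Good x B → (B = ∅ ∧ coversOf x = ∅) ∨ (∃ b, B = {b}) ∨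
    ∃ b ∈ B, Good x (B.erase b) ∧ Good b (coverTrace b (B.erase b))
  good_coversOf : ∀ x, Good x (coversOf x)

theorem coeff_X_mul_nonneg {p : ℚ[X]} (hp : ∀ k, 0 ≤ p.coeff k) (k : ℕ) :
    0 ≤ (X * p).coeff k := by
  cases k with
  | zero => simp
  | succ k => rw [coeff_X_mul]; exact hp k

namespace IsGoodCoverFamily

variable {e : P → ℕ} {Good : P → Finset P → Prop}

open scoped Classical in
theorem step_nonneg (h : IsGoodCoverFamily e Good) {x b : P} {B : Finset P} (hb : x ⋖ b)
    (hbB : b ∉ B) (hB : ∀ b' ∈ B, x ⋖ b')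
    (h1 : ∀ k, 0 ≤ (chainHPolyThrough e b (coverTrace b B)).coeff k)
    (h2 : ∀ k, 0 ≤ (chainHPoly e b - chainHPolyThrough e b (coverTrace b B)).coeff k) (k : ℕ) :
    (chainHPolyThrough e x B).coeff k ≤ (chainHPolyThrough e x (insert b B)).coeff k := by
  rw [chainHPolyThrough_insert h.strictAnti hb (h.covBy_corank x b hb) hbB hB
    fun b' hb' => h.join x b b' hb (hB b' hb') fun hbb' => hbB (hbb' ▸ hb'), coeff_add, coeff_add]
  have := h2 k
  have := coeff_X_mul_nonneg h1 k
  linarith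

/-- The two claims are proved together because the insertion formula for `x` uses both of them, for
the trace, at the cover `b` of smaller corank. -/
theorem coeff_nonneg_aux (h : IsGoodCoverFamily e Good) (n : ℕ) : ∀ x, e x = n → ∀ B, Good x B →
    (∀ k, 0 ≤ (chainHPolyThrough e x B).coeff k) ∧
      ∀ k, 0 ≤ (chainHPoly e x - chainHPolyThrough e x B).coeff k := by
  classical
  induction n using Nat.strong_induction_on with
  | _ n ih =>
  intro x hx B hB
  have ihb : ∀ b, x ⋖ b → ∀ B, Good b B → (∀ k, 0 ≤ (chainHPolyThrough e b B).coeff k) ∧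
      ∀ k, 0 ≤ (chainHPoly e b - chainHPolyThrough e b B).coeff k := fun b hb B hB =>
    ih (e b) (by have := h.covBy_corank x b hb; omega) b rfl B hB
  constructor
  -- Shrink `B` through good sets. The empty set is harmless only at a maximal `x`, where `(1 - X) ^
  -- 0 = 1`.
  · induction hm : B.card using Nat.strong_induction_on generalizing B with
    | _ m ihm =>
    intro k
    rcases h.remove x B hB with ⟨rfl, hc⟩ | ⟨b, rfl⟩ | ⟨b, hbB, hg, ht⟩
    · rw [chainHPolyThrough_empty, h.corank_eq_zero x hc, pow_zero, coeff_one]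
      split_ifs <;> norm_num
    · have hb := h.covBy x _ hB b (Finset.mem_singleton_self b)
      rw [chainHPolyThrough_singleton h.strictAnti hb (h.covBy_corank x b hb),
        ← chainHPolyThrough_coversOf]
      exact (ihb b hb _ (h.good_coversOf b)).1 k
    · have hb := h.covBy x _ hB b hbB
      have h0 := ihm _ (hm ▸ Finset.card_erase_lt_of_mem hbB) _ hg rfl k
      have hs := h.step_nonneg hb (Finset.notMem_erase b B) (h.covBy x _ hg)
        (ihb b hb _ ht).1 (ihb b hb _ ht).2 k
      rw [Finset.insert_erase hbB] at hs
      exact h0.trans hs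
  -- Enlarge `B` through good sets until it contains every cover of `x`.
  · induction hm : (coversOf x \ B).card using Nat.strong_induction_on generalizing B with
    | _ m ihm =>
    intro k
    by_cases hc : B = coversOf x
    · rw [hc, chainHPolyThrough_coversOf, sub_self, coeff_zero]
    obtain ⟨b, hb, hbB, hg, ht⟩ := h.extend x B hB hc
    have hlt : (coversOf x \ insert b B).card < m := by
      rw [← hm]
      refine Finset.card_lt_card (Finset.ssubset_iff_of_subset
        (Finset.sdiff_subset_sdiff le_rfl (Finset.subset_insert b B)) |>.mpr ⟨b, ?_, ?_⟩)
      · simp [mem_coversOf, hb, hbB]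
      · simp
    have h0 := ihm _ hlt _ hg rfl k
    have hs := h.step_nonneg hb hbB (h.covBy x _ hB) (ihb b hb _ ht).1 (ihb b hb _ ht).2 k
    rw [coeff_sub] at h0 ⊢
    linarith

/-- A poset with a good cover family has chain complexes with nonnegative `h`-vectors. -/
theorem coeff_chainHPoly_nonneg (h : IsGoodCoverFamily e Good) (x : P) (k : ℕ) :
    0 ≤ (chainHPoly e x).coeff k := by
  rw [← chainHPolyThrough_coversOf]
  exact (h.coeff_nonneg_aux _ x rfl _ (h.good_coversOf x)).1 k

end IsGoodCoverFamily

end ChainPolynomial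

/-! ### Geometry of flats and their covers -/

/-- By dimension, the direction of `H` together with `v` spans that of `E`. This is the sliding
tool: the moved point stays in every flat through `p` whose direction contains `v`. -/
theorem IsAffineHyperplane.exists_smul_vadd_mem {K : Type*} [Field K] {d : ℕ}
    {E H : AffineSubspace K (Fin d → K)} (h : IsAffineHyperplane E H) {p v : Fin d → K}
    (hp : p ∈ E) (hv : v ∈ E.direction) (hvH : v ∉ H.direction) : ∃ c : K, c • v +ᵥ p ∈ H := by
  obtain ⟨q, hq⟩ := h.nonempty
  have hle : H.direction ⊔ Submodule.span K {v} ≤ E.direction :=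
    sup_le (AffineSubspace.direction_le h.le) (by simpa using hv)
  have hlt : H.direction < H.direction ⊔ Submodule.span K {v} := by
    refine lt_of_le_of_ne le_sup_left fun he => hvH ?_
    rw [he]
    exact Submodule.mem_sup_right (Submodule.mem_span_singleton_self v)
  have heq : H.direction ⊔ Submodule.span K {v} = E.direction := by
    apply Submodule.eq_of_le_of_finrank_le hle
    have := Submodule.finrank_lt_finrank_of_lt hlt
    have := h.finrank_eq
    omega
  have hpq : p -ᵥ q ∈ E.direction := AffineSubspace.vsub_mem_direction hp (h.le hq)
  rw [← heq, Submodule.mem_sup] at hpq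
  obtain ⟨u, hu, w, hw, huw⟩ := hpq
  obtain ⟨c, rfl⟩ := Submodule.mem_span_singleton.mp hw
  -- Since `p - q = u + c • v` with `u` parallel to `H`, the point `p - c • v` equals `q + u`.
  refine ⟨-c, ?_⟩
  have : -c • v +ᵥ p = u +ᵥ q := by
    simp only [vadd_eq_add, vsub_eq_sub] at huw ⊢
    rw [← sub_add_cancel p q, ← huw]
    module
  rw [this]
  exact AffineSubspace.vadd_mem_of_mem_direction hu hq

namespace HyperplaneArrangement

variable {K : Type*} [Field K] {d : ℕ} {A : HyperplaneArrangement K d}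

namespace IntersectionPoset

theorem space_le_space {x y : A.IntersectionPoset} : y.space ≤ x.space ↔ x ≤ y := Iff.rfl

theorem space_lt_space {x y : A.IntersectionPoset} : y.space < x.space ↔ x < y := by
  rw [lt_iff_le_not_ge, lt_iff_le_not_ge, space_le_space, space_le_space]

theorem space_injective : Function.Injective (space : A.IntersectionPoset → _) := fun _ _ h =>
  le_antisymm (space_le_space.mp h.ge) (space_le_space.mp h.le)

theorem space_bot : (⊥ : A.IntersectionPoset).space = A.ambient := rfl

theorem nonempty (x : A.IntersectionPoset) : ∃ p, p ∈ x.space := x.2.1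

open scoped Classical in
/-- The intersection of a flat with a hyperplane of the arrangement that meets it. -/
def infHyperplane (x : A.IntersectionPoset) {H : AffineSubspace K (Fin d → K)}
    (hH : H ∈ A.hyperplanes) {p : Fin d → K} (hpx : p ∈ x.space) (hpH : p ∈ H) :
    A.IntersectionPoset :=
  ⟨OrderDual.toDual (x.space ⊓ H), ⟨p, hpx, hpH⟩, by
    obtain ⟨-, B, hB, hx⟩ := x.2
    refine ⟨insert H B, Finset.insert_subset hH hB, ?_⟩
    have hx' : x.space = A.ambient ⊓ ⨅ H ∈ B, H := hx
    rw [Finset.iInf_insert, OrderDual.ofDual_toDual, hx', inf_assoc, inf_comm H]⟩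

theorem space_infHyperplane (x : A.IntersectionPoset) {H : AffineSubspace K (Fin d → K)}
    (hH : H ∈ A.hyperplanes) {p : Fin d → K} (hpx : p ∈ x.space) (hpH : p ∈ H) :
    (x.infHyperplane hH hpx hpH).space = x.space ⊓ H := rfl

/-- The dimension of a flat. -/
noncomputable def dim (x : A.IntersectionPoset) : ℕ := Module.finrank K x.space.direction

theorem dim_strictAnti : StrictAnti (dim : A.IntersectionPoset → ℕ) := fun _ y h =>
  Submodule.finrank_lt_finrank_of_lt
    (AffineSubspace.direction_lt_of_nonempty (space_lt_space.mpr h) y.2.1)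

/-- Two flats are separated by a hyperplane of the arrangement. -/
theorem exists_hyperplane {x y : A.IntersectionPoset} (h : ¬ y ≤ x) :
    ∃ H ∈ A.hyperplanes, ¬ x.space ≤ H ∧ y.space ≤ H := by
  obtain ⟨-, B, hB, hy⟩ := y.2
  have hy' : y.space = A.ambient ⊓ ⨅ H ∈ B, H := hy
  by_contra! hcon
  refine h (space_le_space.mp ?_)
  rw [hy']
  refine le_inf x.space_le_ambient (le_iInf₂ fun H hH => ?_)
  by_contra hxH
  refine hcon H (hB hH) hxH ?_
  rw [hy']
  exact inf_le_right.trans (iInf₂_le H hH)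

theorem dim_infHyperplane (x : A.IntersectionPoset) {H : AffineSubspace K (Fin d → K)}
    (hH : H ∈ A.hyperplanes) {p : Fin d → K} (hpx : p ∈ x.space) (hpH : p ∈ H)
    (hxH : ¬ x.space ≤ H) : (x.infHyperplane hH hpx hpH).dim + 1 = x.dim :=
  ((A.isHyperplane H hH).inf x.space_le_ambient hxH ⟨p, hpx, hpH⟩).finrank_eq

/-- The dimension drops by exactly one and is strictly antitone, so nothing fits in between. -/
theorem covBy_infHyperplane (x : A.IntersectionPoset) {H : AffineSubspace K (Fin d → K)}
    (hH : H ∈ A.hyperplanes) {p : Fin d → K} (hpx : p ∈ x.space) (hpH : p ∈ H)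
    (hxH : ¬ x.space ≤ H) : x ⋖ x.infHyperplane hH hpx hpH := by
  refine ⟨space_lt_space.mp (lt_of_le_of_ne inf_le_left fun h => hxH ?_), fun z hxz hz => ?_⟩
  · exact h ▸ inf_le_right
  · have h1 := dim_strictAnti hxz
    have h2 := dim_strictAnti hz
    have h3 := x.dim_infHyperplane hH hpx hpH hxH
    omega

/-- Take a hyperplane containing `y` but not `x`. Its intersection with `x` lies strictly above `x`
and below `y`, hence is `y`. -/
theorem exists_hyperplane_of_covBy {x y : A.IntersectionPoset} (h : x ⋖ y) :
    ∃ H ∈ A.hyperplanes, ¬ x.space ≤ H ∧ y.space = x.space ⊓ H := by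
  obtain ⟨H, hH, hxH, hyH⟩ := exists_hyperplane h.lt.not_ge
  refine ⟨H, hH, hxH, ?_⟩
  obtain ⟨p, hp⟩ := y.nonempty
  have hpx : p ∈ x.space := space_le_space.mpr h.le hp
  have hle : x.infHyperplane hH hpx (hyH hp) ≤ y :=
    space_le_space.mp (le_inf (space_le_space.mpr h.le) hyH)
  rcases h.eq_or_eq (x.covBy_infHyperplane hH hpx (hyH hp) hxH).le hle with he | he
  · exact absurd he (x.covBy_infHyperplane hH hpx (hyH hp) hxH).lt.ne'
  · rw [← he, space_infHyperplane]

theorem dim_of_covBy {x y : A.IntersectionPoset} (h : x ⋖ y) : y.dim + 1 = x.dim := by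
  obtain ⟨H, hH, hxH, hy⟩ := exists_hyperplane_of_covBy h
  obtain ⟨p, hp⟩ := y.nonempty
  rw [hy] at hp
  rw [← x.dim_infHyperplane hH hp.1 hp.2 hxH]
  exact congrArg (fun s => Module.finrank K (AffineSubspace.direction s) + 1) hy

/-- Two different flats covering `x` that meet have a join, which covers both. -/
theorem exists_join_of_covBy {x b b' : A.IntersectionPoset} (hb : x ⋖ b) (hb' : x ⋖ b')
    (hne : b ≠ b') {p : Fin d → K} (hp : p ∈ b.space) (hp' : p ∈ b'.space) :
    ∃ y : A.IntersectionPoset, b ⋖ y ∧ y.space = b.space ⊓ b'.space := by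
  obtain ⟨H, hH, hxH, hy⟩ := exists_hyperplane_of_covBy hb'
  have hpH : p ∈ H := (hy ▸ hp' : p ∈ x.space ⊓ H).2
  have hbx := space_le_space.mpr hb.le
  have hbH : ¬ b.space ≤ H := by
    -- Otherwise `b` would be contained in `x ∩ H = b'`, although both cover `x` and differ.
    intro h
    have : b' ≤ b := space_le_space.mp (hy ▸ le_inf hbx h)
    rcases hb.eq_or_eq hb'.le this with h | h
    · exact hb'.lt.ne' h
    · exact hne h.symm
  refine ⟨_, b.covBy_infHyperplane hH hp hpH hbH, ?_⟩
  rw [space_infHyperplane, hy, ← inf_assoc, inf_eq_left.mpr hbx]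

theorem direction_inf {x : A.IntersectionPoset} {H : AffineSubspace K (Fin d → K)}
    {b : A.IntersectionPoset} (hb : b.space = x.space ⊓ H) :
    b.space.direction = x.space.direction ⊓ H.direction := by
  obtain ⟨p, hp⟩ := b.nonempty
  rw [hb] at hp ⊢
  exact AffineSubspace.direction_inf_of_mem_inf hp

/-- A hyperplane not parallel to a flat cuts out a cover of it. -/
theorem exists_covBy_of_not_direction_le (x : A.IntersectionPoset)
    {H : AffineSubspace K (Fin d → K)} (hH : H ∈ A.hyperplanes)
    (hxH : ¬ x.space.direction ≤ H.direction) :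
    ∃ b : A.IntersectionPoset, x ⋖ b ∧ b.space = x.space ⊓ H := by
  obtain ⟨v, hv, hvH⟩ := SetLike.not_le_iff_exists.mp hxH
  obtain ⟨p, hp⟩ := x.nonempty
  obtain ⟨c, hc⟩ := (A.isHyperplane H hH).exists_smul_vadd_mem (x.space_le_ambient hp)
    (AffineSubspace.direction_le x.space_le_ambient hv) hvH
  exact ⟨_, x.covBy_infHyperplane hH (AffineSubspace.vadd_mem_of_mem_direction
    (Submodule.smul_mem _ c hv) hp) hc fun h => hxH (AffineSubspace.direction_le h),
    rfl⟩

end IntersectionPoset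

/-! ### Lineality, corank and good sets of covers -/

open IntersectionPoset

variable (A) in
/-- The directions common to the ambient space and all the hyperplanes. -/
def lineality : Submodule K (Fin d → K) :=
  A.ambient.direction ⊓ ⨅ H ∈ A.hyperplanes, H.direction

theorem mem_lineality {v : Fin d → K} :
    v ∈ A.lineality ↔ v ∈ A.ambient.direction ∧ ∀ H ∈ A.hyperplanes, v ∈ H.direction := by
  simp [lineality, Submodule.mem_iInf]

theorem IntersectionPoset.lineality_le_direction (x : A.IntersectionPoset) :
    A.lineality ≤ x.space.direction := by
  obtain ⟨⟨p, hp⟩, B, hB, hx⟩ := x.2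
  intro v hv
  obtain ⟨hv, hvH⟩ := mem_lineality.mp hv
  have hx' : x.space = A.ambient ⊓ ⨅ H ∈ B, H := hx
  have hp' : p ∈ x.space := hp
  rw [hx'] at hp' ⊢
  rw [AffineSubspace.direction_inf_of_mem_inf hp']
  refine ⟨hv, ?_⟩
  have hp2 := hp'.2
  have hmem : v +ᵥ p ∈ (⨅ H ∈ B, H : AffineSubspace K (Fin d → K)) := by
    simp only [SetLike.mem_coe, AffineSubspace.mem_iInf_iff] at hp2 ⊢
    exact fun H hH => AffineSubspace.vadd_mem_of_mem_direction (hvH H (hB hH)) (hp2 H hH)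
  simpa using AffineSubspace.vsub_mem_direction hmem hp2

/-- The corank of a flat in the intersection poset. -/
noncomputable def corank (x : A.IntersectionPoset) : ℕ := x.dim - Module.finrank K A.lineality

theorem finrank_lineality_le (x : A.IntersectionPoset) :
    Module.finrank K A.lineality ≤ x.dim :=
  Submodule.finrank_mono x.lineality_le_direction

theorem corank_strictAnti : StrictAnti (corank : A.IntersectionPoset → ℕ) := fun x y h => by
  have := dim_strictAnti h
  have := finrank_lineality_le y
  unfold corank
  omega

theorem corank_of_covBy {x b : A.IntersectionPoset} (h : x ⋖ b) : corank b + 1 = corank x := by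
  have := dim_of_covBy h
  have := finrank_lineality_le b
  unfold corank
  omega

/-- A hyperplane not parallel to `x` would cut out a cover. So all maximal flats have the same
direction, which makes the chain complexes pure. -/
theorem lineality_of_isMax {x : A.IntersectionPoset} (h : coversOf x = ∅) :
    x.space.direction ≤ A.lineality := by
  intro v hv
  refine mem_lineality.mpr ⟨AffineSubspace.direction_le x.space_le_ambient hv, fun H hH => ?_⟩
  by_contra hvH
  obtain ⟨b, hb, -⟩ := x.exists_covBy_of_not_direction_le hH fun hle => hvH (hle hv)
  simpa [h] using mem_coversOf.mpr hb

theorem corank_eq_zero {x : A.IntersectionPoset} (h : coversOf x = ∅) : corank x = 0 :=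
  Nat.sub_eq_zero_of_le (Submodule.finrank_mono (lineality_of_isMax h))

/-- A set of flats spans over `x` if together with `x` it has no common direction besides those
shared by the whole arrangement. -/
def IsSpanning (x : A.IntersectionPoset) (B : Finset A.IntersectionPoset) : Prop :=
  ∀ v ∈ x.space.direction, (∀ b ∈ B, v ∈ b.space.direction) → v ∈ A.lineality

/-- A set of flats is central if its members have a common point. -/
def IsCentral (B : Finset A.IntersectionPoset) : Prop :=
  ∃ p, ∀ b ∈ B, p ∈ b.space

/-- The sets of covers of `x` that are spanning, or nonempty and central. -/
def IsGoodCoverSet (x : A.IntersectionPoset) (B : Finset A.IntersectionPoset) : Prop :=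
  (∀ b ∈ B, x ⋖ b) ∧ (IsSpanning x B ∨ B.Nonempty ∧ IsCentral B)

/-- Spanning passes to the trace. A member of `B` cut out by a hyperplane parallel to `b` imposes no
condition on directions of `b`; any other one meets `b` in a member of the trace. -/
theorem isGoodCoverSet_coverTrace_of_isSpanning {x b : A.IntersectionPoset}
    {B : Finset A.IntersectionPoset} (hB : ∀ b' ∈ B, x ⋖ b') (hs : IsSpanning x B) (hb : x ⋖ b) :
    IsGoodCoverSet b (coverTrace b B) := by
  refine ⟨fun y hy => (mem_coverTrace.mp hy).1, Or.inl fun v hv h => ?_⟩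
  have hbx := space_le_space.mpr hb.le
  have hvx := AffineSubspace.direction_le hbx hv
  refine hs v hvx fun b' hb' => ?_
  obtain ⟨H, hH, -, hb'H⟩ := exists_hyperplane_of_covBy (hB b' hb')
  by_cases hbH : b.space.direction ≤ H.direction
  · rw [direction_inf hb'H]
    exact ⟨hvx, hbH hv⟩
  · obtain ⟨y, hy, hyH⟩ := b.exists_covBy_of_not_direction_le hH hbH
    have hle : y.space ≤ b'.space := by
      rw [hyH, hb'H]
      exact inf_le_inf_right H hbx
    exact AffineSubspace.direction_le hle
      (h y (mem_coverTrace.mpr ⟨hy, b', hb', space_le_space.mp hle⟩))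

/-- The point `p` makes `b` meet every `b' ∈ B`, and the trace consists of these intersections, all
of them through `p`. -/
theorem isGoodCoverSet_coverTrace_of_isCentral {x b : A.IntersectionPoset}
    {B : Finset A.IntersectionPoset} (hB : ∀ b' ∈ B, x ⋖ b') (hne : B.Nonempty) {p : Fin d → K}
    (hp : ∀ b' ∈ B, p ∈ b'.space) (hb : x ⋖ b) (hpb : p ∈ b.space) (hbB : b ∉ B) :
    IsGoodCoverSet b (coverTrace b B) := by
  have hjoin : ∀ b' ∈ B, ∃ y : A.IntersectionPoset, b ⋖ y ∧ y.space = b.space ⊓ b'.space :=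
    fun b' hb' => exists_join_of_covBy hb (hB b' hb') (fun h => hbB (h ▸ hb')) hpb (hp b' hb')
  refine ⟨fun y hy => (mem_coverTrace.mp hy).1, Or.inr ⟨?_, p, fun y hy => ?_⟩⟩
  · obtain ⟨b', hb'⟩ := hne
    obtain ⟨y, hy, hys⟩ := hjoin b' hb'
    exact ⟨y, mem_coverTrace.mpr ⟨hy, b', hb', space_le_space.mp (hys ▸ inf_le_right)⟩⟩
  · obtain ⟨hby, b', hb', hb'y⟩ := mem_coverTrace.mp hy
    obtain ⟨z, hz, hzs⟩ := hjoin b' hb'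
    have hzy : z ≤ y := space_le_space.mp
      (hzs ▸ le_inf (space_le_space.mpr hby.le) (space_le_space.mpr hb'y))
    rcases hby.eq_or_eq hz.le hzy with h | h
    · exact absurd h hz.lt.ne'
    · rw [← h, hzs]
      exact ⟨hpb, hp b' hb'⟩

open scoped Classical in
-- A maximal central subset `C` already spans. Otherwise some direction `v` common to `C` is
-- transverse to a member `b` of `B`, and sliding the common point along `v` into `b` makes `insert
-- b C` central.
theorem exists_isCentral_isSpanning {x : A.IntersectionPoset} {B : Finset A.IntersectionPoset}
    (hB : ∀ b ∈ B, x ⋖ b) (hs : IsSpanning x B) :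
    ∃ C ⊆ B, IsSpanning x C ∧ ∃ p, ∀ b ∈ C, p ∈ b.space := by
  obtain ⟨C, hC⟩ := (B.powerset.filter fun C => ∃ p ∈ x.space, ∀ b ∈ C, p ∈ b.space).exists_maximal
    ⟨∅, by simpa using x.nonempty⟩
  obtain ⟨hCB, p, hpx, hpC⟩ := Finset.mem_filter.mp hC.1
  rw [Finset.mem_powerset] at hCB
  refine ⟨C, hCB, fun v hv hvC => hs v hv fun b hb => ?_, p, hpC⟩
  by_contra hvb
  obtain ⟨H, hH, -, hbH⟩ := exists_hyperplane_of_covBy (hB b hb)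
  have hvH : v ∉ H.direction := fun h => hvb (by rw [direction_inf hbH]; exact ⟨hv, h⟩)
  obtain ⟨c, hc⟩ := (A.isHyperplane H hH).exists_smul_vadd_mem (x.space_le_ambient hpx)
    (AffineSubspace.direction_le x.space_le_ambient hv) hvH
  have hq : ∀ y : A.IntersectionPoset, v ∈ y.space.direction → p ∈ y.space →
      c • v +ᵥ p ∈ y.space := fun y hy hp =>
    AffineSubspace.vadd_mem_of_mem_direction (Submodule.smul_mem _ c hy) hp
  have hins : insert b C ∈
      B.powerset.filter fun C => ∃ p ∈ x.space, ∀ b ∈ C, p ∈ b.space := by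
    refine Finset.mem_filter.mpr ⟨Finset.mem_powerset.mpr (Finset.insert_subset hb hCB),
      c • v +ᵥ p, hq x hv hpx, fun y hy => ?_⟩
    rcases Finset.mem_insert.mp hy with rfl | hy
    · rw [hbH]
      exact ⟨hq x hv hpx, hc⟩
    · exact hq y (hvC y hy) (hpC y hy)
  exact hvb (hvC b (hC.2 hins (Finset.subset_insert b C) (Finset.mem_insert_self b C)))

theorem IsSpanning.mono {x : A.IntersectionPoset} {B C : Finset A.IntersectionPoset}
    (h : IsSpanning x B) (hBC : B ⊆ C) : IsSpanning x C :=
  fun v hv hvC => h v hv fun b hb => hvC b (hBC hb)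

open scoped Classical in
-- A spanning set accepts any further cover. A central set that does not span has a common direction
-- transverse to some hyperplane; the common point slides into that hyperplane, whose intersection
-- with `x` is the new cover.
theorem IsGoodCoverSet.exists_insert {x : A.IntersectionPoset} {B : Finset A.IntersectionPoset}
    (h : IsGoodCoverSet x B) (hne : B ≠ coversOf x) :
    ∃ b, x ⋖ b ∧ b ∉ B ∧ IsGoodCoverSet x (insert b B) ∧ IsGoodCoverSet b (coverTrace b B) := by
  obtain ⟨hB, h⟩ := h
  have hins : ∀ b, x ⋖ b → ∀ y ∈ insert b B, x ⋖ y := fun b hb y hy => by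
    rcases Finset.mem_insert.mp hy with rfl | hy
    · exact hb
    · exact hB y hy
  by_cases hs : IsSpanning x B
  · have hsub : B ⊂ coversOf x :=
      lt_of_le_of_ne (fun b hb => mem_coversOf.mpr (hB b hb)) hne
    obtain ⟨b, hb, hbB⟩ := Finset.exists_of_ssubset hsub
    rw [mem_coversOf] at hb
    exact ⟨b, hb, hbB, ⟨hins b hb, Or.inl (hs.mono (Finset.subset_insert b B))⟩,
      isGoodCoverSet_coverTrace_of_isSpanning hB hs hb⟩
  · obtain ⟨hBne, p, hp⟩ := h.resolve_left hs
    unfold IsSpanning at hs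
    push Not at hs
    obtain ⟨v, hv, hvB, hvl⟩ := hs
    have hva := AffineSubspace.direction_le x.space_le_ambient hv
    rw [mem_lineality] at hvl
    push Not at hvl
    obtain ⟨H, hH, hvH⟩ := hvl hva
    obtain ⟨b₀, hb₀⟩ := hBne
    have hpx : p ∈ x.space := space_le_space.mpr (hB b₀ hb₀).le (hp b₀ hb₀)
    obtain ⟨c, hc⟩ := (A.isHyperplane H hH).exists_smul_vadd_mem (x.space_le_ambient hpx) hva hvH
    have hq : ∀ y : A.IntersectionPoset, v ∈ y.space.direction → p ∈ y.space →
        c • v +ᵥ p ∈ y.space := fun y hy hp =>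
      AffineSubspace.vadd_mem_of_mem_direction (Submodule.smul_mem _ c hy) hp
    have hxH : ¬ x.space ≤ H := fun hle => hvH (AffineSubspace.direction_le hle hv)
    have hcov := x.covBy_infHyperplane hH (hq x hv hpx) hc hxH
    set b := x.infHyperplane hH (hq x hv hpx) hc
    have hbs : b.space = x.space ⊓ H := rfl
    have hqb : c • v +ᵥ p ∈ b.space := ⟨hq x hv hpx, hc⟩
    have hqB : ∀ b' ∈ B, c • v +ᵥ p ∈ b'.space := fun b' hb' => hq b' (hvB b' hb') (hp b' hb')
    have hbB : b ∉ B := fun hb => by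
      have := hvB b hb
      rw [direction_inf hbs] at this
      exact hvH this.2
    refine ⟨b, hcov, hbB, ⟨hins b hcov, Or.inr ⟨Finset.insert_nonempty _ _, c • v +ᵥ p, fun y hy => ?_⟩⟩,
      isGoodCoverSet_coverTrace_of_isCentral hB ⟨b₀, hb₀⟩ hqB hcov hqb hbB⟩
    · rcases Finset.mem_insert.mp hy with rfl | hy
      · exact hqb
      · exact hqB y hy

open scoped Classical in
-- From a central set any member may be removed. A set that is not central must span, and removing a
-- member outside a central spanning subset keeps it spanning.
theorem IsGoodCoverSet.exists_erase {x : A.IntersectionPoset} {B : Finset A.IntersectionPoset}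
    (h : IsGoodCoverSet x B) : (B = ∅ ∧ coversOf x = ∅) ∨ (∃ b, B = {b}) ∨
    ∃ b ∈ B, IsGoodCoverSet x (B.erase b) ∧ IsGoodCoverSet b (coverTrace b (B.erase b)) := by
  obtain ⟨hB, h⟩ := h
  have her : ∀ b, ∀ y ∈ B.erase b, x ⋖ y := fun b y hy => hB y (Finset.mem_of_mem_erase hy)
  rcases B.eq_empty_or_nonempty with rfl | hne
  · left
    refine ⟨rfl, Finset.eq_empty_of_forall_notMem fun b hb => ?_⟩
    have hs : IsSpanning x ∅ := h.resolve_right fun h => by simpa using h.1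
    have hlt := AffineSubspace.direction_lt_of_nonempty
      (space_lt_space.mpr (mem_coversOf.mp hb).lt) b.2.1
    -- If the empty set spans, the direction of `x` is the lineality space, which leaves no room for
    -- a smaller flat `b`.
    exact hlt.not_ge fun v hv => b.lineality_le_direction (hs v hv (by simp))
  right
  by_cases hc : IsCentral B
  · obtain ⟨p, hp⟩ := hc
    obtain ⟨b, hb⟩ := hne
    rcases (B.erase b).eq_empty_or_nonempty with he | he
    · left
      refine ⟨b, ?_⟩
      rw [← Finset.insert_erase hb, he, insert_empty_eq]
    · have hpe : ∀ y ∈ B.erase b, p ∈ y.space := fun y hy => hp y (Finset.mem_of_mem_erase hy)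
      exact Or.inr ⟨b, hb, ⟨her b, Or.inr ⟨he, p, hpe⟩⟩,
        isGoodCoverSet_coverTrace_of_isCentral (her b) he hpe (hB b hb) (hp b hb)
          (Finset.notMem_erase b B)⟩
  · right
    have hs := h.resolve_right fun h => hc h.2
    obtain ⟨C, hCB, hCs, hCc⟩ := exists_isCentral_isSpanning hB hs
    have hss : C ⊂ B := lt_of_le_of_ne hCB fun he => hc (he ▸ hCc)
    obtain ⟨b, hb, hbC⟩ := Finset.exists_of_ssubset hss
    have hes : IsSpanning x (B.erase b) := hCs.mono (Finset.subset_erase.mpr ⟨hCB, hbC⟩)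
    exact ⟨b, hb, ⟨her b, Or.inl hes⟩,
      isGoodCoverSet_coverTrace_of_isSpanning (her b) hes (hB b hb)⟩

theorem isGoodCoverSet_coversOf (x : A.IntersectionPoset) : IsGoodCoverSet x (coversOf x) := by
  refine ⟨fun b hb => mem_coversOf.mp hb, Or.inl fun v hv h => ?_⟩
  refine mem_lineality.mpr ⟨AffineSubspace.direction_le x.space_le_ambient hv, fun H hH => ?_⟩
  by_contra hvH
  obtain ⟨b, hb, hbs⟩ := x.exists_covBy_of_not_direction_le hH fun hle => hvH (hle hv)
  have := h b (mem_coversOf.mpr hb)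
  rw [direction_inf hbs] at this
  exact hvH this.2

variable (A) in
theorem isGoodCoverFamily :
    IsGoodCoverFamily (corank : A.IntersectionPoset → ℕ) IsGoodCoverSet where
  covBy _ _ h := h.1
  strictAnti := corank_strictAnti
  covBy_corank _ _ := corank_of_covBy
  corank_eq_zero _ := corank_eq_zero
  join x b b' hb hb' hne z hbz hb'z := by
    obtain ⟨p, hp⟩ := z.nonempty
    obtain ⟨y, hy, hys⟩ := exists_join_of_covBy hb hb' hne (space_le_space.mpr hbz.le hp)
      (space_le_space.mpr hb'z hp)
    exact ⟨y, hy, space_le_space.mp (hys ▸ inf_le_right), space_le_space.mp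
      (hys ▸ le_inf (space_le_space.mpr hbz.le) (space_le_space.mpr hb'z))⟩
  extend _ _ h hne := by convert h.exists_insert hne
  remove _ _ h := by convert h.exists_erase
  good_coversOf := isGoodCoverSet_coversOf

/-! ### Rank as codimension -/

theorem height_lt_top (x : A.IntersectionPoset) : Order.height x < ⊤ := by
  refine lt_of_le_of_lt (b := ((Fintype.card A.IntersectionPoset : ℕ) : ℕ∞)) ?_
    (ENat.natCast_lt_top _)
  refine Order.height_le fun p _ => ?_
  exact_mod_cast (LTSeries.length_lt_card p).le

theorem rk_strictMono : StrictMono A.rk := fun x y hxy => by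
  have h := Order.height_strictMono hxy (height_lt_top x)
  unfold rk
  rwa [← ENat.natCast_toNat (height_lt_top x).ne, ← ENat.natCast_toNat (height_lt_top y).ne,
    Nat.cast_lt] at h

theorem rk_bot : A.rk ⊥ = 0 := by simp [rk]

/-- The rank of a flat is its codimension in the ambient space. -/
theorem rk_add_dim (x : A.IntersectionPoset) : A.rk x + x.dim = (⊥ : A.IntersectionPoset).dim := by
  refine le_antisymm ?_ ?_
  · have h : Order.height x ≤ (((⊥ : A.IntersectionPoset).dim - x.dim : ℕ) : ℕ∞) := by
      refine Order.height_le fun p hp => ?_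
      have hle : ∀ i : ℕ, ∀ hi : i < p.length + 1,
          (p ⟨i, hi⟩).dim + i ≤ (⊥ : A.IntersectionPoset).dim := by
        intro i
        induction i with
        | zero => exact fun hi => dim_strictAnti.antitone (bot_le (a := p ⟨0, hi⟩))
        | succ i ih =>
          intro hi
          have h1 := ih (by omega)
          have h2 := dim_strictAnti (p.strictMono (a := ⟨i, by omega⟩) (b := ⟨i + 1, hi⟩)
            (by simp [Fin.lt_def]))
          omega
      have h1 := hle p.length (by omega)
      have h2 : (p ⟨p.length, by omega⟩) = x := hp
      rw [h2] at h1
      exact_mod_cast (by omega : p.length ≤ (⊥ : A.IntersectionPoset).dim - x.dim)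
    have h2 : x.dim ≤ (⊥ : A.IntersectionPoset).dim := dim_strictAnti.antitone bot_le
    have h3 : A.rk x ≤ (⊥ : A.IntersectionPoset).dim - x.dim := by
      unfold rk
      exact ENat.toNat_le_of_le_natCast h
    omega
  -- Conversely, each cover lowers the dimension by only one while raising the rank.
  · induction x using WellFoundedLT.induction with
    | _ x ih =>
    rcases eq_or_ne x ⊥ with rfl | hx
    · omega
    obtain ⟨y, -, hy⟩ := exists_le_covBy_of_lt (bot_lt_iff_ne_bot.mpr hx)
    have h1 := ih y hy.lt
    have h2 := rk_strictMono hy.lt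
    have h3 := dim_of_covBy hy
    omega

theorem rk_of_covBy {x y : A.IntersectionPoset} (h : x ⋖ y) : A.rk y = A.rk x + 1 := by
  have := rk_add_dim x
  have := rk_add_dim y
  have := dim_of_covBy h
  omega

/-- A flat of largest rank is maximal, so its corank is zero. This identifies the exponent in the
numerator with the one in `chainHPoly`. -/
theorem rank_eq_corank_bot : A.rank = corank (⊥ : A.IntersectionPoset) := by
  refine le_antisymm (Finset.sup_le fun x _ => ?_) ?_
  · have := rk_add_dim x
    have := finrank_lineality_le x
    unfold corank
    omega
  · obtain ⟨x, hx⟩ := Finite.exists_max A.rk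
    have hc : coversOf x = ∅ := Finset.eq_empty_of_forall_notMem fun b hb =>
      (hx b).not_gt (rk_strictMono (mem_coversOf.mp hb).lt)
    have h0 := corank_eq_zero hc
    have h1 := rk_add_dim x
    have h2 : A.rk x ≤ A.rank := Finset.le_sup (f := A.rk) (Finset.mem_univ x)
    unfold corank at h0 ⊢
    omega

end HyperplaneArrangement

/-! ### Signs of the Möbius function and the Poincaré polynomial -/

namespace HyperplaneArrangement

variable {K : Type*} [Field K] {d : ℕ} {A : HyperplaneArrangement K d}

open IntersectionPoset

theorem moebius_bot : A.moebius ⊥ = 1 := by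
  simp [moebius]

open scoped Classical in
theorem sum_moebius_le {x : A.IntersectionPoset} (hx : x ≠ ⊥) :
    ∑ y : A.IntersectionPoset with y ≤ x, A.moebius y = 0 := by
  let _ : LocallyFiniteOrder A.IntersectionPoset := Fintype.toLocallyFiniteOrder
  have h := IncidenceAlgebra.sum_Icc_mu_right (𝕜 := ℤ) (⊥ : A.IntersectionPoset) x
  rw [if_neg hx.symm] at h
  rw [← h]
  refine Finset.sum_congr ?_ fun y _ => rfl
  ext y
  simp

/-- The upper bound `z` provides a point common to `y` and `a`, so their join exists. As `a` is a
single hyperplane, the join is `y` itself or covers it. -/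
theorem exists_inf_atom {a y z : A.IntersectionPoset} (ha : ⊥ ⋖ a) (hyz : y ≤ z) (haz : a ≤ z) :
    ∃ w : A.IntersectionPoset, w.space = y.space ⊓ a.space ∧ (w = y ∨ y ⋖ w) := by
  obtain ⟨H, hH, -, haH⟩ := exists_hyperplane_of_covBy ha
  obtain ⟨p, hp⟩ := z.nonempty
  have hpy := space_le_space.mpr hyz hp
  have hpa := space_le_space.mpr haz hp
  have hpH : p ∈ H := (haH ▸ hpa : p ∈ _ ⊓ H).2
  have hs : (y.infHyperplane hH hpy hpH).space = y.space ⊓ a.space := by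
    rw [space_infHyperplane, haH, ← inf_assoc, space_bot, inf_eq_left.mpr y.space_le_ambient]
  refine ⟨y.infHyperplane hH hpy hpH, hs, ?_⟩
  by_cases h : y.space ≤ H
  · left
    apply space_injective
    rw [space_infHyperplane, inf_eq_left.mpr h]
  · exact Or.inr (y.covBy_infHyperplane hH hpy hpH h)

open scoped Classical in
/-- Weisner's theorem for an atom of an intersection poset. -/
theorem sum_moebius_inf_atom {a : A.IntersectionPoset} (ha : ⊥ ⋖ a) (z : A.IntersectionPoset)
    (haz : a ≤ z) :
    ∑ y : A.IntersectionPoset with z.space = y.space ⊓ a.space, A.moebius y = 0 := by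
  induction z using WellFoundedLT.induction with
  | _ z ih =>
  have hz : z ≠ ⊥ := (ha.lt.trans_le haz).ne'
  -- Group the elements `y` below `z` by their join `w` with `a`. By induction all groups with `w ≠
  -- z` sum to zero.
  have h1 : ∑ y : A.IntersectionPoset with y ≤ z, A.moebius y =
      ∑ w : A.IntersectionPoset with a ≤ w ∧ w ≤ z,
        ∑ y : A.IntersectionPoset with w.space = y.space ⊓ a.space, A.moebius y := by
    simp only [Finset.sum_filter (fun y : A.IntersectionPoset => _ = y.space ⊓ a.space)]
    rw [Finset.sum_comm, Finset.sum_filter]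
    refine Finset.sum_congr rfl fun y _ => ?_
    split_ifs with hyz
    · obtain ⟨w, hw, -⟩ := exists_inf_atom ha hyz haz
      rw [Finset.sum_eq_single w, if_pos hw]
      · intro w' _ hne
        rw [if_neg]
        exact fun h => hne (space_injective (h.trans hw.symm))
      · refine fun h => absurd (Finset.mem_filter.mpr ⟨Finset.mem_univ _, ?_, ?_⟩) h
        · exact space_le_space.mp (hw ▸ inf_le_right)
        · exact space_le_space.mp
            (hw ▸ le_inf (space_le_space.mpr hyz) (space_le_space.mpr haz))
    · symm
      refine Finset.sum_eq_zero fun w hw => if_neg fun h => hyz ?_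
      have : y ≤ w := space_le_space.mp (h ▸ inf_le_left)
      exact this.trans (Finset.mem_filter.mp hw).2.2
  rw [sum_moebius_le hz, Finset.sum_eq_single z] at h1
  · exact h1.symm
  · intro w hw hne
    obtain ⟨haw, hwz⟩ := (Finset.mem_filter.mp hw).2
    exact ih w (lt_of_le_of_ne hwz hne) haw
  · exact fun h => absurd (Finset.mem_filter.mpr ⟨Finset.mem_univ _, haz, le_rfl⟩) h

/-- The Möbius function of an intersection poset alternates in sign. -/
theorem neg_one_pow_mul_moebius_nonneg (z : A.IntersectionPoset) :
    0 ≤ (-1) ^ A.rk z * A.moebius z := by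
  classical
  induction z using WellFoundedLT.induction with
  | _ z ih =>
  rcases eq_or_ne z ⊥ with rfl | hz
  · simp [rk_bot, moebius_bot]
  obtain ⟨a, ha, haz⟩ := exists_covBy_le_of_lt (bot_lt_iff_ne_bot.mpr hz)
  have hmem : z ∈ Finset.univ.filter fun y : A.IntersectionPoset =>
      z.space = y.space ⊓ a.space := by
    simp [inf_eq_left.mpr (space_le_space.mpr haz)]
  have h := sum_moebius_inf_atom ha z haz
  rw [← Finset.add_sum_erase _ _ hmem] at h
  rw [eq_neg_of_add_eq_zero_left h, mul_neg, ← neg_mul, Finset.mul_sum]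
  refine Finset.sum_nonneg fun y hy => ?_
  obtain ⟨hne, hy⟩ := Finset.mem_erase.mp hy
  have hzy := (Finset.mem_filter.mp hy).2
  have hyz : y ≤ z := space_le_space.mp (hzy ▸ inf_le_left)
  obtain ⟨w, hw, hcov⟩ := exists_inf_atom ha hyz haz
  obtain rfl : w = z := space_injective (hw.trans hzy.symm)
  -- Every remaining term of Weisner's sum is covered by the flat in question, so its rank is one
  -- less and the signs agree.
  have hcov := hcov.resolve_left (Ne.symm hne)
  rw [rk_of_covBy hcov, pow_succ, mul_neg_one, neg_neg]
  exact ih y hcov.lt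

theorem coeff_poincare_nonneg (k : ℕ) : 0 ≤ A.poincare.coeff k := by
  rw [poincare, finsetSum_coeff]
  refine Finset.sum_nonneg fun x _ => ?_
  rw [neg_pow, ← C_1, ← C_neg, ← C_pow, ← mul_assoc, ← C_mul, coeff_C_mul_X_pow]
  split_ifs
  · rw [mul_comm]
    exact neg_one_pow_mul_moebius_nonneg x
  · exact le_rfl

theorem eval_zero_poincare : A.poincare.eval 0 = 1 := by
  rw [poincare, eval_finsetSum, Finset.sum_eq_single ⊥]
  · simp [rk_bot, moebius_bot]
  · intro x _ hx
    have : A.rk x ≠ 0 := by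
      have := rk_strictMono (bot_lt_iff_ne_bot.mpr hx)
      omega
    simp [this]
  · simp

/-! ### The numerator and its specialisations -/

theorem ext_of_eq {A B : HyperplaneArrangement K d} (h1 : A.ambient = B.ambient)
    (h2 : A.hyperplanes = B.hyperplanes) : A = B := by
  cases A
  cases B
  cases h1
  cases h2
  rfl

theorem restrict_bot : A.restrict ⊥ = A := by
  classical
  refine ext_of_eq rfl ?_
  have hinf : ∀ H ∈ A.hyperplanes, A.ambient ⊓ H = H := fun H hH =>
    inf_eq_right.mpr (A.isHyperplane H hH).le
  ext H
  constructor
  · intro h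
    obtain ⟨H', hH', rfl⟩ := Finset.mem_image.mp h
    have := (Finset.mem_filter.mp hH').1
    rwa [space_bot, hinf H' this]
  · intro hH
    refine Finset.mem_image.mpr ⟨H, Finset.mem_filter.mpr ⟨hH, fun hle => ?_, ?_⟩, hinf H hH⟩
    · have h := (A.isHyperplane H hH).finrank_eq
      have heq : A.ambient = H := le_antisymm hle (A.isHyperplane H hH).le
      rw [heq] at h
      omega
    · rw [space_bot, hinf H hH]
      exact (A.isHyperplane H hH).nonempty

/-- Here `⊥` is the empty affine subspace, contained in every hyperplane. -/
theorem sub_bot : A.sub ⊥ = A := by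
  classical
  refine ext_of_eq rfl ?_
  simp [sub]

theorem flagPoincare_empty : A.flagPoincare ∅ = A.poincare := by
  have h : A.next ∅ ⊥ = ⊥ := by simp [next]
  rw [flagPoincare, insert_empty_eq, Finset.prod_singleton, h, restrict_bot, sub_bot]

theorem eval_zero_flagPoincare (F : Finset A.IntersectionPoset) :
    (A.flagPoincare F).eval 0 = 1 := by
  rw [flagPoincare, eval_prod]
  exact Finset.prod_eq_one fun x _ => eval_zero_poincare

theorem flags_eq_chainsAbove : A.flags = chainsAbove ⊥ := by
  ext F
  simp only [flags, Finset.mem_filter, Finset.mem_univ, true_and, mem_chainsAbove,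
    bot_lt_iff_ne_bot]
  exact and_congr_right fun _ => ⟨fun h y hy hb => h (hb ▸ hy), fun h hb => h ⊥ hb rfl⟩

/-- Clearing denominators gives this sum; it is polynomial because a flag has at most `A.rank`
members. Uniqueness of the numerator does the rest. -/
theorem coarseNumerator_eq : A.coarseNumerator =
    ∑ F ∈ A.flags, (A.flagPoincare F).map (Int.castRingHom ℚ[X]) *
      C (chainWeight A.rank F) := by
  refine A.existsUnique_coarseNumerator.unique A.coarseNumerator_spec ?_
  have h1 : (1 - RatFunc.X : RatFunc ℚ) = algebraMap ℚ[X] (RatFunc ℚ) (1 - X) := by simp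
  have h0 : (1 - RatFunc.X : RatFunc ℚ) ≠ 0 := by
    rw [h1, Ne, map_eq_zero_iff _ (RatFunc.algebraMap_injective ℚ)]
    intro h
    simpa using congrArg (Polynomial.eval 0) h
  have hring : (algebraMap ℚ[X] (RatFunc ℚ)).comp (Int.castRingHom ℚ[X]) =
      Int.castRingHom (RatFunc ℚ) := RingHom.ext_int _ _
  rw [IsCoarseNumerator, coarseFlagHP, Polynomial.map_sum, Finset.sum_mul]
  refine Finset.sum_congr rfl fun F hF => ?_
  rw [Polynomial.map_mul, Polynomial.map_map, hring, mul_assoc, Polynomial.map_C, ← C_mul,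
    chainWeight, map_mul (algebraMap _ _), map_pow (algebraMap _ _), map_pow (algebraMap _ _), ← h1, RatFunc.algebraMap_X, div_pow,
    pow_sub₀ _ h0 (A.card_le_rank hF)]
  have h2 := pow_ne_zero F.card h0
  have h3 := pow_ne_zero A.rank h0
  congr 2
  field_simp

theorem coarseNumeratorTZero_eq :
    A.coarseNumeratorTZero = A.poincare.map (Int.castRingHom ℚ) := by
  have hring : (evalRingHom (0 : ℚ)).comp (Int.castRingHom ℚ[X]) = Int.castRingHom ℚ :=
    RingHom.ext_int _ _
  rw [coarseNumeratorTZero, coarseNumerator_eq, Polynomial.map_sum, Finset.sum_eq_single ∅]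
  · rw [Polynomial.map_mul, Polynomial.map_map, hring, flagPoincare_empty, Polynomial.map_C]
    simp [chainWeight]
  · intro F _ hF
    rw [Polynomial.map_mul, Polynomial.map_C]
    simp [chainWeight, hF]
  · intro h
    refine absurd ?_ h
    rw [flags_eq_chainsAbove, mem_chainsAbove]
    simp

theorem coarseNumeratorYZero_eq :
    A.coarseNumeratorYZero = chainHPoly corank (⊥ : A.IntersectionPoset) := by
  rw [coarseNumeratorYZero, coarseNumerator_eq, eval_finsetSum, chainHPoly, flags_eq_chainsAbove,
    ← rank_eq_corank_bot]
  refine Finset.sum_congr rfl fun F _ => ?_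
  rw [eval_mul, eval_C, eval_map, eval₂_at_zero, coeff_zero_eq_eval_zero,
    eval_zero_flagPoincare, map_one, one_mul]

theorem eval_zero_coarseFlagHP : A.coarseFlagHP.eval 0 =
    ∑ F ∈ A.flags, (RatFunc.X / (1 - RatFunc.X)) ^ F.card := by
  rw [coarseFlagHP, eval_finsetSum]
  refine Finset.sum_congr rfl fun F _ => ?_
  rw [eval_mul, eval_C, eval_map, eval₂_at_zero, coeff_zero_eq_eval_zero, eval_zero_flagPoincare,
    map_one, one_mul]

end HyperplaneArrangement

/-! ### Hilbert series of Stanley–Reisner rings -/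

section StanleyReisner

variable {ι : Type*}

/-- Membership in a monomial ideal is decided monomial by monomial. Faces are closed under nonempty
subsets, so a support containing a nonface is itself a nonface. -/
theorem mem_stanleyReisnerIdeal {F : Type*} [Field F] {Δ : AbstractSimplicialComplex ι}
    {f : MvPolynomial ι F} : f ∈ stanleyReisnerIdeal F Δ ↔
      ∀ m ∈ f.support, m.support.Nonempty ∧ m.support ∉ Δ.faces := by
  have hset : {m | ∃ σ : Finset ι, σ.Nonempty ∧ σ ∉ Δ.faces ∧
      m = ∏ v ∈ σ, (MvPolynomial.X v : MvPolynomial ι F)} =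
      (fun s => MvPolynomial.monomial s (1 : F)) '' {s | ∃ σ : Finset ι, σ.Nonempty ∧
        σ ∉ Δ.faces ∧ s = ∑ v ∈ σ, Finsupp.single v 1} := by
    ext m
    constructor
    · rintro ⟨σ, h1, h2, rfl⟩
      exact ⟨_, ⟨σ, h1, h2, rfl⟩, MvPolynomial.monomial_sum_one _ _⟩
    · rintro ⟨_, ⟨σ, h1, h2, rfl⟩, rfl⟩
      exact ⟨σ, h1, h2, MvPolynomial.monomial_sum_one _ _⟩
  have hle : ∀ (σ : Finset ι) (m : ι →₀ ℕ),
      ∑ v ∈ σ, Finsupp.single v 1 ≤ m ↔ σ ⊆ m.support := by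
    classical
    intro σ m
    have hval : ∀ i, (∑ v ∈ σ, Finsupp.single v 1 : ι →₀ ℕ) i = if i ∈ σ then 1 else 0 := by
      intro i
      simp [Finsupp.finsetSum_apply, Finsupp.single_apply]
    constructor
    · intro h i hi
      have := h i
      rw [hval, if_pos hi] at this
      rw [Finsupp.mem_support_iff]
      omega
    · intro h i
      rw [hval]
      split_ifs with hi
      · have := Finsupp.mem_support_iff.mp (h hi)
        omega
      · omega
  rw [stanleyReisnerIdeal, hset, MvPolynomial.mem_ideal_span_monomial_image]
  refine forall₂_congr fun m _ => ?_
  constructor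
  · rintro ⟨_, ⟨σ, h1, h2, rfl⟩, h⟩
    rw [hle] at h
    exact ⟨h1.mono h, fun hm => h2 ((Δ.isRelLowerSet_faces hm).2 h h1)⟩
  · rintro ⟨h1, h2⟩
    exact ⟨_, ⟨m.support, h1, h2, rfl⟩, (hle _ _).mpr le_rfl⟩

/-- The exponents of degree `k` supported on a face (or on the empty set). -/
def faceExponents (Δ : AbstractSimplicialComplex ι) (k : ℕ) : Set (ι →₀ ℕ) :=
  {m | m.degree = k ∧ (m.support.Nonempty → m.support ∈ Δ.faces)}

theorem stanleyReisnerPiece_eq_map (F : Type*) [Field F] (Δ : AbstractSimplicialComplex ι)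
    (k : ℕ) : stanleyReisnerPiece F Δ k =
      (MvPolynomial.restrictSupport F (faceExponents Δ k)).map
        (Ideal.Quotient.mkₐ F (stanleyReisnerIdeal F Δ)).toLinearMap := by
  have hhom : MvPolynomial.homogeneousSubmodule ι F k =
      MvPolynomial.restrictSupport F {m | m.degree = k} :=
    MvPolynomial.homogeneousSubmodule_eq_finsupp_supported ι F k
  rw [stanleyReisnerPiece, hhom]
  apply le_antisymm
  · rw [MvPolynomial.restrictSupport_eq_span, Submodule.map_span, Submodule.span_le]
    rintro _ ⟨_, ⟨m, hm, rfl⟩, rfl⟩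
    by_cases hf : m.support.Nonempty → m.support ∈ Δ.faces
    · exact Submodule.mem_map_of_mem
        ((MvPolynomial.monomial_mem_restrictSupport F).mpr (Or.inl ⟨hm, hf⟩))
    · push Not at hf
      have hI : MvPolynomial.monomial m (1 : F) ∈ stanleyReisnerIdeal F Δ := by
        classical
        rw [mem_stanleyReisnerIdeal]
        intro m' hm'
        rw [MvPolynomial.support_monomial, if_neg one_ne_zero, Finset.mem_singleton] at hm'
        exact hm' ▸ hf
      have h0 : (Ideal.Quotient.mkₐ F (stanleyReisnerIdeal F Δ)).toLinearMap
          (MvPolynomial.monomial m (1 : F)) = 0 := Ideal.Quotient.eq_zero_iff_mem.mpr hI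
      rw [h0]
      exact Submodule.zero_mem _
  · exact Submodule.map_mono (MvPolynomial.restrictSupport_mono F fun m hm => hm.1)

/-- The monomials supported on faces stay independent in the quotient, since every monomial of an
element of the ideal has a nonface as support. -/
theorem finrank_stanleyReisnerPiece (F : Type*) [Field F] (Δ : AbstractSimplicialComplex ι)
    (k : ℕ) : Module.finrank F (stanleyReisnerPiece F Δ k) = Nat.card (faceExponents Δ k) := by
  set f := (Ideal.Quotient.mkₐ F (stanleyReisnerIdeal F Δ)).toLinearMap.domRestrict
    (MvPolynomial.restrictSupport F (faceExponents Δ k))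
  have hinj : Function.Injective f := by
    rw [← LinearMap.ker_eq_bot, LinearMap.ker_eq_bot']
    rintro ⟨p, hp⟩ h
    have hI : p ∈ stanleyReisnerIdeal F Δ := Ideal.Quotient.eq_zero_iff_mem.mp h
    rw [mem_stanleyReisnerIdeal] at hI
    rw [MvPolynomial.mem_restrictSupport_iff] at hp
    apply Subtype.ext
    change p = 0
    rw [← MvPolynomial.support_eq_empty]
    refine Finset.eq_empty_of_forall_notMem fun m hm => ?_
    exact (hI m hm).2 ((hp hm).2 (hI m hm).1)
  have hrange : LinearMap.range f = stanleyReisnerPiece F Δ k := by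
    rw [stanleyReisnerPiece_eq_map, LinearMap.range_domRestrict]
  rw [← hrange, LinearMap.finrank_range_of_inj hinj,
    Module.finrank_eq_nat_card_basis (MvPolynomial.basisRestrictSupport F (faceExponents Δ k))]

/-- The power series `T / (1 - T)`. -/
noncomputable def geomTail : PowerSeries ℚ := PowerSeries.mk fun n => if n = 0 then 0 else 1

theorem geomTail_mul : geomTail * (1 - PowerSeries.X) = PowerSeries.X := by
  ext n
  rw [mul_sub, mul_one, map_sub]
  rcases n with _ | n
  · simp [geomTail]
  · rw [PowerSeries.coeff_succ_mul_X, PowerSeries.coeff_X]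
    rcases n with _ | n <;> simp [geomTail]

open scoped Classical in
-- Expanding the product over `σ`, each factor demands a positive exponent, so only exponents with
-- full support `σ` count.
theorem coeff_geomTail_pow (σ : Finset ι) (k : ℕ) : PowerSeries.coeff k (geomTail ^ σ.card) =
    (((Finset.finsuppAntidiag σ k).filter fun m => m.support = σ).card : ℚ) := by
  rw [← Finset.prod_const, PowerSeries.coeff_prod, Finset.card_filter, Nat.cast_sum]
  refine Finset.sum_congr rfl fun m hm => ?_
  have hsub := (Finset.mem_finsuppAntidiag.mp hm).2
  simp only [geomTail, PowerSeries.coeff_mk]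
  split_ifs with h
  · rw [Nat.cast_one]
    refine Finset.prod_eq_one fun i hi => if_neg ?_
    rwa [← h, Finsupp.mem_support_iff] at hi
  · obtain ⟨i, hi, him⟩ := Finset.exists_of_ssubset (lt_of_le_of_ne hsub h)
    rw [Nat.cast_zero]
    exact Finset.prod_eq_zero hi (if_pos (Finsupp.notMem_support_iff.mp him))

open scoped Classical in
/-- The Hilbert series of a Stanley-Reisner ring in terms of the face numbers. -/
theorem stanleyReisnerHilbertSeries_eq (F : Type*) [Field F] [Fintype ι]
    (Δ : AbstractSimplicialComplex ι) : stanleyReisnerHilbertSeries F Δ =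
      ∑ σ : Finset ι with σ.Nonempty → σ ∈ Δ.faces, geomTail ^ σ.card := by
  ext k
  have hset : faceExponents Δ k = ((Finset.finsuppAntidiag Finset.univ k).filter fun m =>
      m.support.Nonempty → m.support ∈ Δ.faces : Finset (ι →₀ ℕ)) := by
    ext m
    simp [faceExponents, Finset.mem_finsuppAntidiag, Finsupp.degree_eq_sum]
  -- Sort the surviving monomials by their support.
  rw [stanleyReisnerHilbertSeries, PowerSeries.coeff_mk, finrank_stanleyReisnerPiece, hset,
    Nat.card_coe_set_eq, Set.ncard_coe_finset, map_sum,
    Finset.card_eq_sum_card_fiberwise (f := Finsupp.support)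
      (t := Finset.univ.filter fun σ : Finset ι => σ.Nonempty → σ ∈ Δ.faces), Nat.cast_sum]
  · refine Finset.sum_congr rfl fun σ hσ => ?_
    rw [coeff_geomTail_pow]
    congr 2
    ext m
    simp only [Finset.mem_filter, Finset.mem_finsuppAntidiag]
    constructor
    · rintro ⟨⟨⟨h1, -⟩, -⟩, rfl⟩
      refine ⟨⟨?_, le_rfl⟩, rfl⟩
      rw [← h1]
      exact Finset.sum_subset (Finset.subset_univ _) fun i _ hi => Finsupp.notMem_support_iff.mp hi
    · rintro ⟨⟨h1, -⟩, rfl⟩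
      refine ⟨⟨⟨?_, Finset.subset_univ _⟩, (Finset.mem_filter.mp hσ).2⟩, rfl⟩
      rw [← h1]
      symm
      exact Finset.sum_subset (Finset.subset_univ _) fun i _ hi => Finsupp.notMem_support_iff.mp hi
  · intro m hm
    simpa using (Finset.mem_filter.mp hm).2

end StanleyReisner

/-! ### The cone over the flags and the Hilbert series identity -/

namespace HyperplaneArrangement

variable {K : Type*} [Field K] {d : ℕ} {A : HyperplaneArrangement K d}

/-- The order complex of the intersection poset is a cone over the complex of flags. -/
theorem stanleyReisnerHilbertSeries_mul (F : Type*) [Field F] :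
    stanleyReisnerHilbertSeries F (orderComplex A.IntersectionPoset) * (1 - PowerSeries.X) =
      ∑ G ∈ A.flags, geomTail ^ G.card := by
  classical
  have hnot : ∀ G ∈ A.flags, ⊥ ∉ G := fun G hG => (Finset.mem_filter.mp hG).2.2
  -- A chain of `L(A)` either is a flag or becomes one on removing `0̂`.
  have hunion : (Finset.univ.filter fun σ : Finset A.IntersectionPoset =>
      σ.Nonempty → σ ∈ (orderComplex A.IntersectionPoset).faces) =
      A.flags ∪ A.flags.image (insert ⊥) := by
    have hface : ∀ σ : Finset A.IntersectionPoset,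
        (σ.Nonempty → σ ∈ (orderComplex A.IntersectionPoset).faces) ↔
          IsChain (· ≤ ·) (σ : Set A.IntersectionPoset) := by
      intro σ
      constructor
      · intro h
        rcases σ.eq_empty_or_nonempty with rfl | hne
        · simp [IsChain]
        · exact (h hne).2
      · exact fun h hne => ⟨hne, h⟩
    ext σ
    simp only [hface, Finset.mem_filter, Finset.mem_univ, true_and, Finset.mem_union,
      Finset.mem_image, flags]
    constructor
    · intro h
      by_cases hb : ⊥ ∈ σ
      · refine Or.inr ⟨σ.erase ⊥, ⟨h.mono ?_, Finset.notMem_erase _ _⟩, Finset.insert_erase hb⟩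
        exact_mod_cast Finset.erase_subset _ _
      · exact Or.inl ⟨h, hb⟩
    · rintro (⟨h, -⟩ | ⟨G, ⟨h, -⟩, rfl⟩)
      · exact h
      · rw [Finset.coe_insert]
        exact h.insert fun y _ _ => Or.inl bot_le
  have himage : ∑ σ ∈ A.flags.image (insert ⊥), geomTail ^ σ.card =
      geomTail * ∑ G ∈ A.flags, geomTail ^ G.card := by
    rw [Finset.sum_image, Finset.mul_sum]
    · refine Finset.sum_congr rfl fun G hG => ?_
      rw [Finset.card_insert_of_notMem (hnot G hG), pow_succ, mul_comm]
    · intro G hG G' hG' h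
      have := congrArg (fun s => Finset.erase s ⊥) h
      simpa [Finset.erase_insert (hnot G hG), Finset.erase_insert (hnot G' hG')] using this
  have hdisj : Disjoint A.flags (A.flags.image (insert ⊥)) := by
    rw [Finset.disjoint_right]
    intro σ hσ hσ'
    obtain ⟨G, -, rfl⟩ := Finset.mem_image.mp hσ
    exact hnot _ hσ' (Finset.mem_insert_self _ _)
  have hS : stanleyReisnerHilbertSeries F (orderComplex A.IntersectionPoset) =
      (1 + geomTail) * ∑ G ∈ A.flags, geomTail ^ G.card := by
    rw [stanleyReisnerHilbertSeries_eq, one_add_mul, ← himage, ← Finset.sum_union hdisj, ← hunion]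
  have h1 : (1 + geomTail) * (1 - PowerSeries.X) = 1 := by
    rw [add_mul, geomTail_mul]
    ring
  rw [hS, mul_right_comm, h1, one_mul]

theorem laurentExpansion_X : laurentExpansion RatFunc.X =
    ((PowerSeries.X : PowerSeries ℚ) : LaurentSeries ℚ) := by
  rw [PowerSeries.coe_X]
  exact RatFunc.coe_X

/-- The expansion is a ring homomorphism, so it suffices to send `T / (1 - T)` to `geomTail` and
compare both sides after multiplying by `1 - T`. -/
theorem laurentExpansion_coarseFlagHP (F : Type*) [Field F] :
    laurentExpansion (A.coarseFlagHP.eval 0 / (1 - RatFunc.X)) =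
      ((stanleyReisnerHilbertSeries F (orderComplex A.IntersectionPoset) : PowerSeries ℚ) :
        LaurentSeries ℚ) := by
  have h1 : laurentExpansion (1 - RatFunc.X) =
      HahnSeries.ofPowerSeries ℤ ℚ (1 - PowerSeries.X) := by
    rw [map_sub, map_sub, map_one, map_one, laurentExpansion_X]
  have h0 : HahnSeries.ofPowerSeries ℤ ℚ (1 - PowerSeries.X) ≠ 0 := by
    rw [Ne, map_eq_zero_iff _ HahnSeries.ofPowerSeries_injective]
    intro h
    simpa using congrArg (PowerSeries.coeff 0) h
  have hg : laurentExpansion (RatFunc.X / (1 - RatFunc.X)) =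
      HahnSeries.ofPowerSeries ℤ ℚ geomTail := by
    rw [map_div₀, h1, div_eq_iff h0, ← map_mul, geomTail_mul, laurentExpansion_X]
  rw [map_div₀, h1, div_eq_iff h0, ← map_mul, stanleyReisnerHilbertSeries_mul,
    eval_zero_coarseFlagHP, map_sum, map_sum]
  exact Finset.sum_congr rfl fun G _ => by rw [map_pow, map_pow, hg]

end HyperplaneArrangement

theorem mainTheorem6 {K : Type*} [Field K] {d : ℕ} (A : HyperplaneArrangement K d) :
    A.coarseNumeratorTZero = A.poincare.map (Int.castRingHom ℚ) ∧
    (∀ (F : Type*) [Field F],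
      laurentExpansion (A.coarseFlagHP.eval 0 / (1 - RatFunc.X)) =
        ((stanleyReisnerHilbertSeries F (orderComplex A.IntersectionPoset) : PowerSeries ℚ) :
          LaurentSeries ℚ)) ∧
    (∀ k : ℕ, 0 ≤ A.coarseNumeratorTZero.coeff k) ∧
    (∀ k : ℕ, 0 ≤ A.coarseNumeratorYZero.coeff k) := by
  refine ⟨HyperplaneArrangement.coarseNumeratorTZero_eq,
    fun F _ => HyperplaneArrangement.laurentExpansion_coarseFlagHP F, fun k => ?_, fun k => ?_⟩
  · rw [HyperplaneArrangement.coarseNumeratorTZero_eq, coeff_map]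
    exact Int.cast_nonneg (HyperplaneArrangement.coeff_poincare_nonneg k)
  · rw [HyperplaneArrangement.coarseNumeratorYZero_eq]
    exact A.isGoodCoverFamily.coeff_chainHPoly_nonneg _ k
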